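/- Let $k$ and $\ell$ be positive integers and let $0 < c \le \left(4-\frac{4}{2k+1}\right)\ell$. For every $n$, every real $W \ge 0$ and every undirected graph $G$ with $n$ vertices and edge weights in $[0,W]$ there is a distance oracle with stretch $\left(2k-1+\frac1\ell,\, 4kW\right)$, space $\widetilde{O}\!\left(n^{1+\frac1k\left(1-\frac{c}{8\ell}\right)}\right)$ and query time $O(n^c)$. That is: there are a word-RAM program and a word length of $O(\log n)$ bits, and for each such $G$ a data structure of $\widetilde{O}\!\left(n^{1+\frac1k\left(1-\frac{c}{8\ell}\right)}\right)$ words, such that, for all vertices $s,t$, the program run on the data structure and the query $(s,t)$ halts after $O(n^c)$ steps and outputs an estimate $\widehat d(s,t)\in[0,\infty]$ with $$d(s,t) \;\le\; \widehat d(s,t) \;\le\; \left(2k-1+\tfrac1\ell\right) d(s,t) + 4kW ,$$ where $d(s,t)$ is the distance in $G$ ($+\infty$ if $s$ and $t$ are not connected). The estimate is output as two words, the numerator and the denominator of $\widehat d(s,t)/W$ (denominator $0$ standing for $\widehat d(s,t)=\infty$; if $W=0$, every other pair stands for $0$). The program and the constants and the exponent of the logarithm hidden in the asymptotic bounds depend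 only on $k$, $\ell$ and $c$; $\widetilde{O}$ hides factors polylogarithmic in $n$. -/

import Mathlib

open scoped NNReal ENNReal
open Filter

/-! ### A word RAM -/

namespace WordRAM

/-- Instructions of the word RAM. The numbers `d`, `a`, `b` name registers, `v` is a constant and
`l` is a position in the program. -/
inductive Instr : Type
  /-- `R[d] := v` -/
  | const (d v : ℕ)
  /-- `R[d] := R[a] + R[b]` (modulo the word range) -/
  | add (d a b : ℕ)
  /-- `R[d] := R[a] - R[b]` (truncated at zero) -/
  | sub (d a b : ℕ)
  /-- `R[d] := R[a] * R[b]` (modulo the word range) -/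
  | mul (d a b : ℕ)
  /-- `R[d] := ⌊R[a] / R[b]⌋` -/
  | div (d a b : ℕ)
  /-- `R[d] := M[R[a]]` -/
  | load (d a : ℕ)
  /-- `M[R[a]] := R[b]` -/
  | store (a b : ℕ)
  /-- go to position `l` if `R[a] < R[b]` -/
  | jlt (a b l : ℕ)
  /-- go to position `l` if `R[a] = R[b]` -/
  | jeq (a b l : ℕ)

/-- A program is a finite list of instructions. It mentions only finitely many registers. -/
abbrev Program : Type := List Instr

/-- A configuration: program counter, registers, and random access memory. -/
@[ext]
structure State : Type where
  pc : ℕ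
  reg : ℕ → ℕ
  mem : ℕ → ℕ

/-- Write the word `x` to register `d` and go to the next instruction. -/
def State.setReg (σ : State) (d x : ℕ) : State :=
  { σ with pc := σ.pc + 1, reg := Function.update σ.reg d x }

/-- The effect of one instruction on a machine with words of `b` bits, i.e. numbers below `2 ^ b`. -/
def Instr.exec (b : ℕ) (σ : State) : Instr → State
  | .const d v => σ.setReg d (v % 2 ^ b)
  | .add d x y => σ.setReg d ((σ.reg x + σ.reg y) % 2 ^ b)
  | .sub d x y => σ.setReg d (σ.reg x - σ.reg y)
  | .mul d x y => σ.setReg d ((σ.reg x * σ.reg y) % 2 ^ b)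
  | .div d x y => σ.setReg d (σ.reg x / σ.reg y)
  | .load d x => σ.setReg d (σ.mem (σ.reg x))
  | .store x y => { σ with pc := σ.pc + 1, mem := Function.update σ.mem (σ.reg x) (σ.reg y) }
  | .jlt x y l => { σ with pc := if σ.reg x < σ.reg y then l else σ.pc + 1 }
  | .jeq x y l => { σ with pc := if σ.reg x = σ.reg y then l else σ.pc + 1 }

/-- One step of the program `P`; a configuration whose program counter has left the program
does not change any more. -/
def step (b : ℕ) (P : Program) (σ : State) : State :=
  match P[σ.pc]? with
  | some i => i.exec b σ
  | none => σ

/-- The program has halted: the program counter has left the program. -/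
def Halted (P : Program) (σ : State) : Prop := P.length ≤ σ.pc

/-- The initial configuration for the query `(s, t)` to the data structure `D`: the memory holds
the words of `D` from address `0` on and zeros elsewhere, registers `0` and `1` hold `s` and `t`, and
all other registers hold zero. -/
def init (D : List ℕ) (s t : ℕ) : State where
  pc := 0
  reg := fun r => if r = 0 then s else if r = 1 then t else 0
  mem := fun a => D.getD a 0

end WordRAM

/-! ### Distances and distance oracles -/

/-- The distance from `s` to `t` in the undirected graph `G` with edge weights `w`: the least total
weight of a walk, and `∞` if there is none. -/
noncomputable def weightedDist {V : Type*} (G : SimpleGraph V) (w : Sym2 V → ℝ≥0) (s t : V) :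
    ℝ≥0∞ :=
  ⨅ p : G.Walk s t, (((p.edges.map w).sum : ℝ≥0) : ℝ≥0∞)

/-- The number represented by the pair of words `(x, y)`, in units of `W`: the pair stands for
`(x / y) * W` if `y ≠ 0`, and for `∞` if `y = 0`. -/
noncomputable def decodeEstimate (W : ℝ≥0) (x y : ℕ) : ℝ≥0∞ :=
  if y = 0 then ⊤ else (((x : ℝ≥0) / (y : ℝ≥0) * W : ℝ≥0) : ℝ≥0∞)

/-- The list `D` of words of `b` bits, together with the query program `P`, is a distance oracle
for the undirected graph `G` with edge weights `w`, all at most `W`. It has stretch `(α, β)`,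
takes at most `S` words of space and answers every query in at most `T` steps. The answer is found in
registers `0` and `1` when the program halts. -/
structure IsDistanceOracle {n : ℕ} (b : ℕ) (P : WordRAM.Program) (D : List ℕ)
    (G : SimpleGraph (Fin n)) (w : Sym2 (Fin n) → ℝ≥0) (W : ℝ≥0) (α β : ℝ≥0∞) (S T : ℕ) :
    Prop where
  isWord : ∀ x ∈ D, x < 2 ^ b
  space : D.length ≤ S
  query : ∀ s t : Fin n, ∃ τ ≤ T, ∃ σ : WordRAM.State,
    (WordRAM.step b P)^[τ] (WordRAM.init D s t) = σ ∧ WordRAM.Halted P σ ∧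
    weightedDist G w s t ≤ decodeEstimate W (σ.reg 0) (σ.reg 1) ∧
    decodeEstimate W (σ.reg 0) (σ.reg 1) ≤ α * weightedDist G w s t + β

/-! Put `y = c / (8ℓ(k+1))`. Every vertex `v` stores a near set `N v` of about `n^y` nearest
vertices. A hitting set of all near sets, of size about `n^(1-y) log n`, provides a pivot `p v ∈ N
v` for every `v` (`Finset.exists_hitting`). On the pivots alone a Thorup–Zwick structure, made
deterministic by hitting sets, has stretch `2k-1` (`exists_hubs`). Up to logarithms it takes
`n^((1-y)(1+1/k))` words, which is the required space, and the upper bound on `c` makes the near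
lists, of `n^(1+y)` words, no larger.

Passing from `x` and `y` to their pivots costs an additional `2k (δ x (p x) + δ y (p y))`, so the
pivots of `s` and `t` may be too far away. The query therefore tries all sequences of `M = 8kℓ + 2`
moves, each taking one of the two current vertices to a member of its near set. Some sequence
follows a shortest path to vertices with close pivots (`exists_move`, `Reach.exists_good`). Indeed,
let the path from `x` leave `N x` along the edge `uu'`. Either `u' ∉ N u`, and then `p u` is within
one edge weight of `u`; or `x → u → u'` are two moves, which advance at least by `δ x (p x)`. Put `g
= 4kℓ` and `d = δ s t`. As long as pivots are farther than about `d/g`, the second case occurs at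
most `g` times. So after `2g + 2` moves the two vertices have met, or both pivots are within about
`d/g + W`. The estimate is then at most `(2k-1) d + 2k · 2 (d/(4kℓ) + W) = (2k-1+1/ℓ) d + 4kW`. No
sequence underestimates the distance, by the triangle inequality (`Tables.le_best_of_hubs`). There
are `O(n^(yM))` sequences, and `yM < c` leaves room for logarithmic factors.

To have integers in the words, weights are rounded up to multiples of `W/Q` with `Q = 4kℓn`. A path
with at most `n` edges gains at most `n` units, and a slack of `2kn` units in the additive term
absorbs this (`weightedDist_estimate`). Distances are capped at a number `INF`, which makes them a
finite semimetric on a possibly disconnected graph. The machine is treated by a calculus of triples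
`Ends`, which carry a time bound and a postcondition. -/

namespace WordRAM

/-! ### Structured programs with time bounds -/

/-- A code fragment, as a function of the position at which it is placed. -/
abbrev Code : Type := ℕ → List Instr

/-- The test of a conditional jump. -/
inductive Test : Type
  | lt (a b : ℕ)
  | eq (a b : ℕ)

def Test.holds (r : ℕ → ℕ) : Test → Prop
  | .lt a b => r a < r b
  | .eq a b => r a = r b

def Test.jump (l : ℕ) : Test → Instr
  | .lt a b => .jlt a b l
  | .eq a b => .jeq a b l

namespace Code

def block (l : List Instr) : Code := fun _ => l

def seq (c d : Code) : Code := fun o => c o ++ d (o + (c o).length)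

/-- The branch `d` comes first and ends with the unconditional jump `jeq 0 0` over `c`. So the
overhead is one step if the test holds and two if it fails. -/
def ite (t : Test) (c d : Code) : Code := fun o =>
  t.jump (o + 1 + ((d (o + 1)).length + 1)) ::
    (d (o + 1) ++ (.jeq 0 0 (o + 1 + ((d (o + 1)).length + 1) +
        (c (o + 1 + ((d (o + 1)).length + 1))).length) ::
      c (o + 1 + ((d (o + 1)).length + 1))))

def loop (t : Test) (c : Code) : Code := fun o =>
  t.jump (o + 2) :: .jeq 0 0 (o + 2 + ((c (o + 2)).length + 1)) ::
    (c (o + 2) ++ [.jeq 0 0 o])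

/-- The fragments `c 0, …, c (m - 1)`, one after the other. -/
def unroll (c : ℕ → Code) : ℕ → Code
  | 0 => block []
  | m + 1 => seq (unroll c m) (c m)

end Code

/-- The list `l` occurs in the program `P` at position `o`. -/
def OccursAt (P : Program) (o : ℕ) (l : List Instr) : Prop :=
  ∀ i < l.length, P[o + i]? = l[i]?

theorem OccursAt.left {P : Program} {o : ℕ} {l l' : List Instr} (h : OccursAt P o (l ++ l')) :
    OccursAt P o l := fun i hi => by
  rw [h i (by rw [List.length_append]; omega), List.getElem?_append_left hi]

theorem OccursAt.right {P : Program} {o : ℕ} {l l' : List Instr} (h : OccursAt P o (l ++ l')) :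
    OccursAt P (o + l.length) l' := fun i hi => by
  rw [add_assoc, h _ (by rw [List.length_append]; omega),
    List.getElem?_append_right (by omega), Nat.add_sub_cancel_left]

theorem OccursAt.head {P : Program} {o : ℕ} {i : Instr} {l : List Instr}
    (h : OccursAt P o (i :: l)) : P[o]? = some i := by simpa using h 0 (by simp)

theorem OccursAt.tail {P : Program} {o : ℕ} {i : Instr} {l : List Instr}
    (h : OccursAt P o (i :: l)) : OccursAt P (o + 1) l :=
  OccursAt.right (l := [i]) h

variable {b : ℕ} {mem : ℕ → ℕ}

/-- The fragment `c`, started with registers `r`, runs for `τ` steps and ends with registers `r'`,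
leaving the memory as it is. -/
def Runs (b : ℕ) (mem : ℕ → ℕ) (c : Code) (r r' : ℕ → ℕ) (τ : ℕ) : Prop :=
  ∀ (P : Program) (o : ℕ), OccursAt P o (c o) →
    (step b P)^[τ] ⟨o, r, mem⟩ = ⟨o + (c o).length, r', mem⟩

/-- The effect on the registers of an instruction that neither jumps nor writes to the memory. -/
def regStep (b : ℕ) (mem : ℕ → ℕ) (r : ℕ → ℕ) : Instr → ℕ → ℕ
  | .const d v => Function.update r d (v % 2 ^ b)
  | .add d x y => Function.update r d ((r x + r y) % 2 ^ b)
  | .sub d x y => Function.update r d (r x - r y)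
  | .mul d x y => Function.update r d ((r x * r y) % 2 ^ b)
  | .div d x y => Function.update r d (r x / r y)
  | .load d x => Function.update r d (mem (r x))
  | .store _ _ => r
  | .jlt _ _ _ => r
  | .jeq _ _ _ => r

def Instr.Straight : Instr → Prop
  | .store _ _ => False
  | .jlt _ _ _ => False
  | .jeq _ _ _ => False
  | _ => True

theorem step_of_straight {P : Program} {o : ℕ} {i : Instr} (h : P[o]? = some i)
    (hi : i.Straight) (r : ℕ → ℕ) : step b P ⟨o, r, mem⟩ = ⟨o + 1, regStep b mem r i, mem⟩ := by
  cases i <;> first | exact hi.elim | simp [step, h, Instr.exec, State.setReg, regStep]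

theorem runs_block (l : List Instr) (hl : ∀ i ∈ l, i.Straight) (r : ℕ → ℕ) :
    Runs b mem (.block l) r (l.foldl (regStep b mem) r) l.length := by
  induction l generalizing r with
  | nil => intro P o _; simp [Code.block]
  | cons i l ih =>
    intro P o h
    rw [List.length_cons, Function.iterate_succ_apply,
      step_of_straight (OccursAt.head h) (hl i (by simp))]
    rw [ih (fun j hj => hl j (by simp [hj])) _ P (o + 1) (OccursAt.tail h)]
    simp [Code.block]; omega

/-- `Runs` quantifies over all programs and all positions in them, so fragments compose without any
relocation. -/
theorem Runs.seq {c d : Code} {r r₁ r₂ : ℕ → ℕ} {τ₁ τ₂ : ℕ} (h₁ : Runs b mem c r r₁ τ₁)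
    (h₂ : Runs b mem d r₁ r₂ τ₂) : Runs b mem (c.seq d) r r₂ (τ₁ + τ₂) := by
  intro P o h
  rw [add_comm, Function.iterate_add_apply, h₁ P o h.left, h₂ P _ h.right]
  simp [Code.seq, add_assoc]

theorem step_jump {P : Program} {o l : ℕ} {t : Test} {r : ℕ → ℕ}
    (h : P[o]? = some (t.jump l)) (ht : t.holds r) : step b P ⟨o, r, mem⟩ = ⟨l, r, mem⟩ := by
  cases t <;> simp_all [step, Test.jump, Test.holds, Instr.exec]

theorem step_not_jump {P : Program} {o l : ℕ} {t : Test} {r : ℕ → ℕ}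
    (h : P[o]? = some (t.jump l)) (ht : ¬ t.holds r) :
    step b P ⟨o, r, mem⟩ = ⟨o + 1, r, mem⟩ := by
  cases t
  · simp_all [step, Test.jump, Test.holds, Instr.exec]
  · simp_all [step, Test.jump, Test.holds, Instr.exec]

theorem step_goto {P : Program} {o l : ℕ} {r : ℕ → ℕ} (h : P[o]? = some (.jeq 0 0 l)) :
    step b P ⟨o, r, mem⟩ = ⟨l, r, mem⟩ :=
  step_jump (t := .eq 0 0) h rfl

theorem Runs.ite_true {t : Test} {c d : Code} {r r' : ℕ → ℕ} {τ : ℕ} (ht : t.holds r)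
    (h : Runs b mem c r r' τ) : Runs b mem (.ite t c d) r r' (τ + 1) := by
  intro P o hP
  rw [Function.iterate_succ_apply, step_jump hP.head ht]
  have h1 := hP.tail.right.tail
  rw [add_assoc (o + 1)] at h1
  rw [h P _ h1]
  simp [Code.ite]; omega

theorem Runs.ite_false {t : Test} {c d : Code} {r r' : ℕ → ℕ} {τ : ℕ} (ht : ¬ t.holds r)
    (h : Runs b mem d r r' τ) : Runs b mem (.ite t c d) r r' (τ + 2) := by
  intro P o hP
  rw [Function.iterate_succ_apply, step_not_jump hP.head ht, Function.iterate_succ_apply',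
    h P _ hP.tail.left, step_goto hP.tail.right.head]
  simp [Code.ite]; omega

theorem Runs.loop_false {t : Test} {c : Code} {r : ℕ → ℕ} (ht : ¬ t.holds r) :
    Runs b mem (.loop t c) r r 2 := by
  intro P o hP
  rw [Function.iterate_succ_apply, step_not_jump hP.head ht, Function.iterate_one,
    step_goto hP.tail.head]
  simp [Code.loop]; omega

theorem Runs.loop_true {t : Test} {c : Code} {r r₁ r₂ : ℕ → ℕ} {τ₁ τ₂ : ℕ} (ht : t.holds r)
    (h₁ : Runs b mem c r r₁ τ₁) (h₂ : Runs b mem (.loop t c) r₁ r₂ τ₂) :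
    Runs b mem (.loop t c) r r₂ (τ₁ + 2 + τ₂) := by
  intro P o hP
  rw [add_comm, Function.iterate_add_apply, Function.iterate_succ_apply, step_jump hP.head ht,
    Function.iterate_succ_apply', h₁ P _ hP.tail.tail.left, step_goto hP.tail.tail.right.head,
    h₂ P o hP]

/-- The fragment `c`, started with registers `r`, ends within `T` steps with registers that satisfy
`Q`. -/
def Ends (b : ℕ) (mem : ℕ → ℕ) (c : Code) (r : ℕ → ℕ) (T : ℕ) (Q : (ℕ → ℕ) → Prop) : Prop :=
  ∃ τ ≤ T, ∃ r', Runs b mem c r r' τ ∧ Q r'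

variable {c d : Code} {r : ℕ → ℕ} {T T₁ T₂ : ℕ} {Q Q₁ : (ℕ → ℕ) → Prop} {t : Test}

theorem Ends.mono (h : Ends b mem c r T₁ Q₁) (hT : T₁ ≤ T) (hQ : ∀ r', Q₁ r' → Q r') :
    Ends b mem c r T Q := by
  obtain ⟨τ, hτ, r', hr, hq⟩ := h
  exact ⟨τ, hτ.trans hT, r', hr, hQ _ hq⟩

theorem Ends.block {l : List Instr} (hl : ∀ i ∈ l, i.Straight) (hT : l.length ≤ T)
    (hQ : Q (l.foldl (regStep b mem) r)) : Ends b mem (.block l) r T Q :=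
  ⟨_, hT, _, runs_block l hl r, hQ⟩

theorem Ends.seq (h₁ : Ends b mem c r T₁ Q₁) (h₂ : ∀ r₁, Q₁ r₁ → Ends b mem d r₁ T₂ Q) :
    Ends b mem (c.seq d) r (T₁ + T₂) Q := by
  obtain ⟨τ₁, hτ₁, r₁, hr₁, hq₁⟩ := h₁
  obtain ⟨τ₂, hτ₂, r₂, hr₂, hq₂⟩ := h₂ r₁ hq₁
  exact ⟨_, add_le_add hτ₁ hτ₂, r₂, hr₁.seq hr₂, hq₂⟩

theorem Ends.ite (h₁ : t.holds r → Ends b mem c r T Q) (h₂ : ¬ t.holds r → Ends b mem d r T Q) :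
    Ends b mem (.ite t c d) r (T + 2) Q := by
  by_cases ht : t.holds r
  · obtain ⟨τ, hτ, r', hr, hq⟩ := h₁ ht
    exact ⟨τ + 1, by omega, r', hr.ite_true ht, hq⟩
  · obtain ⟨τ, hτ, r', hr, hq⟩ := h₂ ht
    exact ⟨τ + 2, by omega, r', hr.ite_false ht, hq⟩

/-- A loop with an invariant `I j`, where `j` bounds the number of iterations to come. -/
theorem Ends.loop {I : ℕ → (ℕ → ℕ) → Prop}
    (hstep : ∀ j r, I (j + 1) r → t.holds r → Ends b mem c r T (I j))
    (hend : ∀ r, I 0 r → ¬ t.holds r) {j : ℕ} (hr : I j r) :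
    Ends b mem (.loop t c) r (j * (T + 2) + 2) (fun r' => ∃ i, I i r' ∧ ¬ t.holds r') := by
  induction j generalizing r with
  | zero => exact ⟨2, by omega, r, Runs.loop_false (hend r hr), 0, hr, hend r hr⟩
  | succ j ih =>
    by_cases ht : t.holds r
    · obtain ⟨τ₁, hτ₁, r₁, hr₁, hq₁⟩ := hstep j r hr ht
      obtain ⟨τ₂, hτ₂, r₂, hr₂, hq₂⟩ := ih hq₁
      refine ⟨_, ?_, r₂, Runs.loop_true ht hr₁ hr₂, hq₂⟩
      rw [add_mul]; omega
    · exact ⟨2, by omega, r, Runs.loop_false ht, j + 1, hr, ht⟩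

/-- The invariant `I j` holds after `j` of the fragments. -/
theorem Ends.unroll {c : ℕ → Code} {I : ℕ → (ℕ → ℕ) → Prop} {m : ℕ}
    (hstep : ∀ j < m, ∀ r, I j r → Ends b mem (c j) r T (I (j + 1))) (hr : I 0 r) :
    Ends b mem (.unroll c m) r (m * T) (I m) := by
  induction m with
  | zero => exact Ends.block (by simp) (by simp) hr
  | succ m ih =>
    rw [Nat.succ_mul]
    exact (ih fun j hj => hstep j (by omega)).seq (hstep m (by omega))

end WordRAM

/-! ### The tables of the oracle and the query program -/

namespace WordRAM

/-- The contents of the distance oracle: for each vertex a list of `K` near vertices with their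
distances, a pivot, and the hubs of the pivot, and a dictionary with `m` keys. -/
structure Tables : Type where
  n : ℕ
  K : ℕ
  m : ℕ
  inf : ℕ
  scale : ℕ
  ballVertex : ℕ → ℕ
  ballDist : ℕ → ℕ
  pivot : ℕ → ℕ
  radius : ℕ → ℕ
  key : ℕ → ℕ
  value : ℕ → ℕ
  hub : ℕ → ℕ → ℕ
  hubDist : ℕ → ℕ → ℕ

namespace Tables

/-- Entries 0 to 5 stay in registers 4 to 9 during the whole query. Entry 6, the denominator of the
output, is read only at the end. -/
def header (D : Tables) (M : ℕ) : ℕ → ℕ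
  | 0 => (2 * D.K) ^ M
  | 1 => D.K
  | 2 => D.n
  | 3 => D.m
  | 4 => D.inf
  | 5 => 2 * D.K
  | 6 => D.scale
  | _ => 0

/-- The entry `i` of the table `j`. -/
def entry (D : Tables) (M : ℕ) (j i : ℕ) : ℕ :=
  match j with
  | 0 => D.header M i
  | 1 => D.ballVertex i
  | 2 => D.ballDist i
  | 3 => D.pivot i
  | 4 => D.radius i
  | 5 => D.key i
  | 6 => D.value (D.key i)
  -- The hubs number `i` are table `2 * i + 7`, their distances table `2 * i + 8`.
  | j + 7 => if j % 2 = 0 then D.hub (j / 2) i else D.hubDist (j / 2) i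

open Classical in
/-- The value of a key in the dictionary, and `inf` if the key does not occur. -/
noncomputable def look (D : Tables) (q : ℕ) : ℕ :=
  if ∃ i < D.m, D.key i = q then D.value q else D.inf

/-- One step of the search, with state `(x, y, acc, e)`: depending on the last digit of `e`, one of
the vertices `x` and `y` moves to a near vertex, and `acc` adds up the lengths of the moves. -/
def move (D : Tables) (z : ℕ × ℕ × ℕ × ℕ) : ℕ × ℕ × ℕ × ℕ :=
  if z.2.2.2 % (2 * D.K) < D.K then
    (D.ballVertex (z.1 * D.K + z.2.2.2 % (2 * D.K)), z.2.1,
      z.2.2.1 + D.ballDist (z.1 * D.K + z.2.2.2 % (2 * D.K)), z.2.2.2 / (2 * D.K))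
  else
    (z.1, D.ballVertex (z.2.1 * D.K + (z.2.2.2 % (2 * D.K) - D.K)),
      z.2.2.1 + D.ballDist (z.2.1 * D.K + (z.2.2.2 % (2 * D.K) - D.K)), z.2.2.2 / (2 * D.K))

/-- The estimate of the distance from `x` to `y` through the hub number `i` of the pivot of `x`. -/
noncomputable def cand (D : Tables) (x y acc i : ℕ) : ℕ :=
  D.hubDist i x + D.look (D.pivot y * D.n + D.hub i x) + (D.radius y + acc)

end Tables

/-- The minimum of `a` and `f 0, …, f (j - 1)`. -/
def minUpto (f : ℕ → ℕ) (a : ℕ) : ℕ → ℕ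
  | 0 => a
  | j + 1 => min (minUpto f a j) (f j)

namespace Tables

/-- The minimum of `a` and the estimates obtained from the search with the code `e`. -/
noncomputable def improve (D : Tables) (M k s t e a : ℕ) : ℕ :=
  let z := D.move^[M] (s, t, 0, e)
  minUpto (D.cand z.2.1 z.1 z.2.2.1)
    (minUpto (D.cand z.1 z.2.1 z.2.2.1) (if z.1 = z.2.1 then min a z.2.2.1 else a) k) k

/-- The digits of a code in base `2 * D.K` are the moves, the last digit being the first move. Hence
the codes below `(2 * D.K) ^ M` exhaust all sequences of `M` moves. -/
noncomputable def best (D : Tables) (M k s t : ℕ) : ℕ → ℕ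
  | 0 => D.inf
  | e + 1 => D.improve M k s t e (D.best M k s t e)

/-- The tables and all numbers that occur in a query fit into words of `b` bits. -/
structure Fits (D : Tables) (b M k S J : ℕ) : Prop where
  two_lt : 2 < 2 ^ b
  seven_le : 7 ≤ S
  size_le : (2 * k + 7) * S ≤ 2 ^ b
  m_pos : 0 < D.m
  m_le : D.m ≤ S
  m_le_pow : D.m ≤ 2 ^ J
  key_lt : ∀ i j, i < j → j < D.m → D.key i < D.key j
  K_pos : 0 < D.K
  ball_le : D.n * D.K ≤ S
  ballVertex_lt : ∀ i < D.n * D.K, D.ballVertex i < D.n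
  ballDist_le : ∀ i < D.n * D.K, D.ballDist i ≤ D.inf
  pivot_lt : ∀ i < D.n, D.pivot i < D.n
  radius_le : ∀ i < D.n, D.radius i ≤ D.inf
  hub_lt : ∀ i < D.n, ∀ j < k, D.hub j i < D.n
  hubDist_le : ∀ i < D.n, ∀ j < k, D.hubDist j i ≤ 2 * D.inf
  value_le : ∀ i < D.m, D.value (D.key i) ≤ D.inf
  -- A candidate is at most `2 * inf` (way to the hub) plus `inf` (dictionary) plus `inf` (radius)
  -- plus `M * inf` (moves), so no sum overflows.
  inf_lt : (M + 4) * D.inf < 2 ^ b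
  sq_lt : D.n * D.n < 2 ^ b
  codes_lt : (2 * D.K) ^ M < 2 ^ b

end Tables

namespace Code

/-- Load the entry of the table `j` whose index is in register `a` into register `d`, if there are
`R` tables. -/
def fetch (R d j a : ℕ) : Code :=
  block [.const 30 R, .mul 30 30 a, .const 31 j, .add 30 30 31, .load d 30]

/-- Binary search for the key in register `15`; the value is written to register `16`. -/
def lookup (R : ℕ) : Code :=
  -- Registers 17 and 18 bound the half-open search interval, and register 22 is its lower end plus
  -- one. Register 14 holds zero, so that `sub d x 14` copies a register.
  ((((block [.const 17 0, .const 20 1, .const 21 2, .sub 18 7 14, .add 22 17 20]).seq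
    (loop (.lt 22 18)
      (((block [.add 19 17 18, .div 19 19 21]).seq (fetch R 23 5 19)).seq
        (ite (.lt 15 23) (block [.sub 18 19 14])
          (block [.sub 17 19 14, .add 22 17 20]))))).seq
    (fetch R 23 5 17)).seq
    (ite (.eq 23 15) (fetch R 16 6 17) (block [.sub 16 8 14])))

/-- Registers: 0 and 1 hold the query, 2 the best estimate, 3 the code, 10 and 11 the current
vertices, 12 the length of the moves. Register 13 holds the digits still to be read and, after the
moves, the radius plus the length. -/
def candidate (R i : ℕ) : Code :=
  ((((((fetch R 16 3 11).seq (block [.mul 16 16 6])).seq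
    (fetch R 17 (2 * i + 7) 10)).seq (block [.add 15 16 17])).seq (lookup R)).seq
    (fetch R 17 (2 * i + 8) 10)).seq
    ((block [.add 17 17 16, .add 17 17 13]).seq
      (ite (.lt 17 2) (block [.sub 2 17 14]) (block [])))

def candidates (R k : ℕ) : Code :=
  ((fetch R 13 4 11).seq (block [.add 13 13 12])).seq (unroll (candidate R) k)

def move (R : ℕ) : Code :=
  (block [.div 16 13 9, .mul 17 16 9, .sub 15 13 17, .sub 13 16 14]).seq
    (ite (.lt 15 5)
      ((((block [.mul 16 10 5, .add 16 16 15]).seq (fetch R 10 1 16)).seq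
        (fetch R 17 2 16)).seq (block [.add 12 12 17]))
      ((((block [.sub 15 15 5, .mul 16 11 5, .add 16 16 15]).seq (fetch R 11 1 16)).seq
        (fetch R 17 2 16)).seq (block [.add 12 12 17])))

def improve (R M k : ℕ) : Code :=
  ((((((block [.sub 10 0 14, .sub 11 1 14, .sub 12 14 14, .sub 13 3 14]).seq
    (unroll (fun _ => move R) M)).seq
    (ite (.eq 10 11) (ite (.lt 12 2) (block [.sub 2 12 14]) (block [])) (block []))).seq
    (candidates R k)).seq
    -- The two vertices are exchanged: it is not known whose pivot has its hub in the bunch of the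
    -- other.
    (block [.sub 16 10 14, .sub 10 11 14, .sub 11 16 14])).seq
    (candidates R k)).seq
    (block [.const 16 1, .add 3 3 16])

def readHeader (R : ℕ) : Code :=
  unroll (fun i => (block [.const 16 i]).seq (fetch R (i + 4) 0 16)) 6

def query (M k : ℕ) : Code :=
  (((readHeader (2 * k + 7)).seq (block [.sub 2 8 14])).seq
    (loop (.lt 3 4) (improve (2 * k + 7) M k))).seq
    (ite (.lt 2 8)
      (((block [.const 16 6]).seq (fetch (2 * k + 7) 1 0 16)).seq (block [.sub 0 2 14]))
      (block [.sub 0 14 14, .sub 1 14 14]))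

end Code

/-! ### Correctness of table access and dictionary look-up -/

section

variable {D : Tables} {b M k S J : ℕ} {mem : ℕ → ℕ} {r : ℕ → ℕ}

/-- The memory holds the tables of `D`, interleaved. -/
def Holds (D : Tables) (M k S : ℕ) (mem : ℕ → ℕ) : Prop :=
  ∀ j < 2 * k + 7, ∀ i < S, mem ((2 * k + 7) * i + j) = D.entry M j i

/-- Since the tables are interleaved, the address needs only their number `2 * k + 7` and not their
length. This keeps the program independent of `n`. -/
theorem ends_fetch (hD : D.Fits b M k S J) (hmem : Holds D M k S mem) {d j a : ℕ}
    (ha : a < 30) (hj : j < 2 * k + 7) (hi : r a < S) :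
    Ends b mem (.fetch (2 * k + 7) d j a) r 5
      (fun r' => r' d = D.entry M j (r a) ∧ ∀ i < 30, i ≠ d → r' i = r i) := by
  have h1 : (2 * k + 7) * r a + j < 2 ^ b := by
    have := Nat.mul_le_mul_left (2 * k + 7) (Nat.succ_le_of_lt hi)
    have := hD.size_le
    rw [Nat.mul_succ] at *
    omega
  have h2 : 2 * k + 7 < 2 ^ b := by
    have := Nat.mul_le_mul_left (2 * k + 7) hD.seven_le
    have := hD.size_le
    omega
  apply Ends.block
  · simp [Instr.Straight]
  · simp
  · have e1 : (2 * k + 7) % 2 ^ b = 2 * k + 7 := Nat.mod_eq_of_lt h2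
    have e2 : j % 2 ^ b = j := Nat.mod_eq_of_lt (by omega)
    have e3 : (2 * k + 7) * r a % 2 ^ b = (2 * k + 7) * r a := Nat.mod_eq_of_lt (by omega)
    have e4 := Nat.mod_eq_of_lt h1
    have ha' : a ≠ 30 := by omega
    constructor
    · simp [regStep, e1, e2, e3, e4, ha', hmem j hj _ hi]
    · intro i hi hid
      have : i ≠ 30 := by omega
      have : i ≠ 31 := by omega
      simp [regStep, Function.update_of_ne, *]

/-- Binary search. Every index of the key stays in the interval, whose length is at most `2 ^ j`
when `j` rounds are left; `D.m ≤ 2 ^ J` therefore allows `J` rounds of at most 13 steps. One last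
comparison tells whether the key occurs at all. -/
theorem ends_lookup (hD : D.Fits b M k S J) (hmem : Holds D M k S mem) (h7 : r 7 = D.m)
    (h8 : r 8 = D.inf) (h14 : r 14 = 0) :
    Ends b mem (.lookup (2 * k + 7)) r (13 * J + 19)
      (fun r' => r' 16 = D.look (r 15) ∧ ∀ i < 16, r' i = r i) := by
  have hX := hD.two_lt
  have hmX : D.m < 2 ^ b ∧ 2 * D.m < 2 ^ b := by
    have := Nat.mul_le_mul_left (2 * k + 7) hD.m_le
    have := hD.size_le
    have := hD.m_pos
    have : 7 * D.m ≤ (2 * k + 7) * D.m := Nat.mul_le_mul_right _ (by omega)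
    omega
  have c0 : 0 % 2 ^ b = 0 := Nat.zero_mod _
  have c1 : 1 % 2 ^ b = 1 := Nat.mod_eq_of_lt (by omega)
  have c2 : 2 % 2 ^ b = 2 := Nat.mod_eq_of_lt hX
  have hm := hD.m_pos
  let I : ℕ → (ℕ → ℕ) → Prop := fun j r' =>
    (r' 17 < r' 18 ∧ r' 18 ≤ D.m ∧ r' 18 - r' 17 ≤ 2 ^ j ∧ r' 22 = r' 17 + 1 ∧ r' 20 = 1 ∧
      r' 21 = 2) ∧ (∀ i < D.m, D.key i = r 15 → r' 17 ≤ i ∧ i < r' 18) ∧ ∀ i < 16, r' i = r i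
  have hT : 13 * J + 19 = 5 + (J * (11 + 2) + 2) + 5 + (5 + 2) := by ring
  rw [hT]
  refine Ends.seq (Ends.seq (Ends.seq (Q₁ := I J) ?_ (fun r₁ h₁ => Ends.loop (I := I) ?_ ?_ h₁))
    (fun r₂ h₂ => ?_)) ?_ (Q₁ := fun r' => I 0 r' ∧ r' 23 = D.key (r' 17))
  · apply Ends.block (by simp [Instr.Straight]) (by simp)
    refine ⟨?_, ?_, ?_⟩
    · simp [regStep, c1, c2, h7, h14, hm, hD.m_le_pow]
    · simp only [regStep, List.foldl, c0]
      simpa [h7, h14] using fun i hi _ => hi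
    · intro i hi
      have : i ≠ 17 := by omega
      have : i ≠ 18 := by omega
      have : i ≠ 20 := by omega
      have : i ≠ 21 := by omega
      have : i ≠ 22 := by omega
      simp [regStep, Function.update_of_ne, *]
  · rintro j r' ⟨⟨a1, a2, a3, a4, a5, a6⟩, hk, hr⟩ ht
    have ht : r' 22 < r' 18 := ht
    have hmid : (r' 17 + r' 18) % 2 ^ b = r' 17 + r' 18 := Nat.mod_eq_of_lt (by omega)
    set mid := (r' 17 + r' 18) / 2 with hmiddef
    rw [show 11 = 2 + 5 + (2 + 2) from rfl]
    refine Ends.seq (Ends.seq (Q₁ := fun r₂ => r₂ 19 = mid ∧ ∀ i < 30, i ≠ 19 → r₂ i = r' i) ?_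
      (fun r₂ h₂ => ?_)) ?_ (Q₁ := fun r₂ => r₂ 23 = D.key mid ∧ r₂ 19 = mid ∧
        ∀ i < 23, i ≠ 19 → r₂ i = r' i)
    · apply Ends.block (by simp [Instr.Straight]) (by simp)
      refine ⟨by simp [regStep, hmid, a6, hmiddef], ?_⟩
      intro i _ hi
      simp [regStep, Function.update_of_ne, hi]
    · have hS := hD.m_le
      refine (ends_fetch hD hmem (by norm_num) (by omega) (by omega)).mono le_rfl ?_
      rintro r₃ ⟨h3, h4⟩
      refine ⟨by rw [h3, h₂.1]; rfl, by rw [h4 19 (by norm_num) (by norm_num), h₂.1], ?_⟩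
      intro i hi hi'
      rw [h4 i (by omega) (by omega), h₂.2 i (by omega) hi']
    · rintro r₂ ⟨b1, b2, b3⟩
      have e14 : r₂ 14 = 0 := by rw [b3 14 (by norm_num) (by norm_num), hr 14 (by norm_num), h14]
      have e15 : r₂ 15 = r 15 := by rw [b3 15 (by norm_num) (by norm_num), hr 15 (by norm_num)]
      have e17 : r₂ 17 = r' 17 := b3 17 (by norm_num) (by norm_num)
      have e18 : r₂ 18 = r' 18 := b3 18 (by norm_num) (by norm_num)
      have e20 : r₂ 20 = 1 := by rw [b3 20 (by norm_num) (by norm_num), a5]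
      have e21 : r₂ 21 = 2 := by rw [b3 21 (by norm_num) (by norm_num), a6]
      have e22 : r₂ 22 = r' 17 + 1 := by rw [b3 22 (by norm_num) (by norm_num), a4]
      rw [pow_succ] at a3
      refine Ends.ite (fun h => ?_) (fun h => ?_)
      · have h : r 15 < D.key mid := by rw [← e15, ← b1]; exact h
        apply Ends.block (by simp [Instr.Straight]) (by simp)
        refine ⟨?_, ?_, ?_⟩
        · simp [regStep, e14, e20, e21, e22, e17, b2]
          omega
        · intro i hi hi'
          simp only [regStep, List.foldl, e14, b2, Function.update_self, Nat.sub_zero]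
          rw [Function.update_of_ne (by norm_num), e17]
          refine ⟨(hk i hi hi').1, ?_⟩
          by_contra hcon
          rcases eq_or_lt_of_le (not_lt.1 hcon) with h' | h'
          · rw [h', hi'] at h; omega
          · have := hD.key_lt _ _ h' hi
            omega
        · intro i hi
          simp only [regStep, List.foldl]
          rw [Function.update_of_ne (by omega), b3 i (by omega) (by omega), hr i hi]
      · have h : D.key mid ≤ r 15 := by rw [← e15, ← b1]; exact not_lt.1 h
        apply Ends.block (by simp [Instr.Straight]) (by simp)
        have e1 : (mid + 1) % 2 ^ b = mid + 1 := Nat.mod_eq_of_lt (by omega)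
        refine ⟨?_, ?_, ?_⟩
        · simp [regStep, e14, e20, e21, e18, b2, e1]
          omega
        · intro i hi hi'
          simp [regStep, e14, e18, b2]
          refine ⟨?_, (hk i hi hi').2⟩
          by_contra hcon
          have := hD.key_lt _ _ (not_le.1 hcon) (by omega)
          omega
        · intro i hi
          simp only [regStep, List.foldl]
          rw [Function.update_of_ne (by omega), Function.update_of_ne (by omega),
            b3 i (by omega) (by omega), hr i hi]
  · rintro r' ⟨⟨a1, a2, a3, a4, a5, a6⟩, hk, hr⟩ ht
    have ht : r' 22 < r' 18 := ht
    omega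
  · obtain ⟨j, ⟨⟨a1, a2, a3, a4, a5, a6⟩, hk, hr⟩, ht⟩ := h₂
    have ht : r₂ 18 ≤ r₂ 22 := not_lt.1 ht
    have hS := hD.m_le
    refine (ends_fetch hD hmem (by norm_num) (by omega) (by omega)).mono le_rfl ?_
    rintro r₃ ⟨h3, h4⟩
    have e17 := h4 17 (by norm_num) (by norm_num)
    have e18 := h4 18 (by norm_num) (by norm_num)
    have e20 := h4 20 (by norm_num) (by norm_num)
    have e21 := h4 21 (by norm_num) (by norm_num)
    have e22 := h4 22 (by norm_num) (by norm_num)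
    refine ⟨⟨⟨?_, ?_, ?_, ?_, ?_, ?_⟩, ?_, fun i hi => ?_⟩, ?_⟩
    · omega
    · omega
    · rw [pow_zero]; omega
    · omega
    · omega
    · omega
    · rw [e17, e18]; exact hk
    · rw [h4 i (by omega) (by omega), hr i hi]
    · rw [h3, e17]; rfl
  · rintro r₃ ⟨⟨⟨a1, a2, a3, a4, a5, a6⟩, hk, hr⟩, h23⟩
    rw [pow_zero] at a3
    have hlo : r₃ 17 < D.m := by omega
    have e15 := hr 15 (by norm_num)
    refine Ends.ite (fun h => ?_) (fun h => ?_)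
    · have h : D.key (r₃ 17) = r 15 := by rw [← h23, ← e15]; exact h
      have hS := hD.m_le
      refine (ends_fetch hD hmem (by norm_num) (by omega) (by omega)).mono le_rfl ?_
      rintro r₄ ⟨h3, h4⟩
      refine ⟨?_, fun i hi => ?_⟩
      · rw [h3, Tables.look, if_pos ⟨_, hlo, h⟩, ← h]; rfl
      · rw [h4 i (by omega) (by omega), hr i hi]
    · have h : D.key (r₃ 17) ≠ r 15 := by rw [← h23, ← e15]; exact h
      apply Ends.block (by simp [Instr.Straight]) (by simp)
      refine ⟨?_, fun i hi => ?_⟩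
      · simp only [regStep, List.foldl, Function.update_self]
        rw [hr 8 (by norm_num), hr 14 (by norm_num), h8, h14, Tables.look, if_neg]
        · rfl
        · rintro ⟨i, hi, hi'⟩
          have := hk i hi hi'
          obtain rfl : i = r₃ 17 := by omega
          exact h hi'
      · simp only [regStep, List.foldl]
        rw [Function.update_of_ne (by omega), hr i hi]

theorem Tables.Fits.look_le (hD : D.Fits b M k S J) (q : ℕ) : D.look q ≤ D.inf := by
  unfold Tables.look
  split_ifs with h
  · obtain ⟨i, hi, rfl⟩ := h
    exact hD.value_le i hi
  · exact le_rfl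

end

end WordRAM

/-! ### Correctness and running time of the query -/

namespace WordRAM

variable {D : Tables} {b M k S J : ℕ} {mem : ℕ → ℕ} {r : ℕ → ℕ}

theorem ends_add {d x y : ℕ} (h : r x + r y < 2 ^ b) :
    Ends b mem (.block [.add d x y]) r 1
      (fun r' => r' d = r x + r y ∧ ∀ i, i ≠ d → r' i = r i) := by
  apply Ends.block (by simp [Instr.Straight]) (by simp)
  refine ⟨by simp [regStep, Nat.mod_eq_of_lt h], fun i hi => ?_⟩
  simp [regStep, Function.update_of_ne hi]

theorem ends_mul {d x y : ℕ} (h : r x * r y < 2 ^ b) :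
    Ends b mem (.block [.mul d x y]) r 1
      (fun r' => r' d = r x * r y ∧ ∀ i, i ≠ d → r' i = r i) := by
  apply Ends.block (by simp [Instr.Straight]) (by simp)
  refine ⟨by simp [regStep, Nat.mod_eq_of_lt h], fun i hi => ?_⟩
  simp [regStep, Function.update_of_ne hi]

theorem ends_copy {d x : ℕ} (h : r 14 = 0) :
    Ends b mem (.block [.sub d x 14]) r 1 (fun r' => r' d = r x ∧ ∀ i, i ≠ d → r' i = r i) := by
  apply Ends.block (by simp [Instr.Straight]) (by simp)
  refine ⟨by simp [regStep, h], fun i hi => ?_⟩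
  simp [regStep, Function.update_of_ne hi]

/-- The parameters of `D` are in the registers `4` to `9`, and register `14` is zero. -/
structure Ready (D : Tables) (M : ℕ) (r : ℕ → ℕ) : Prop where
  r4 : r 4 = (2 * D.K) ^ M
  r5 : r 5 = D.K
  r6 : r 6 = D.n
  r7 : r 7 = D.m
  r8 : r 8 = D.inf
  r9 : r 9 = 2 * D.K
  r14 : r 14 = 0

theorem Ready.congr {r' : ℕ → ℕ} (h : Ready D M r)
    (he : ∀ i < 15, 4 ≤ i → i < 10 ∨ i = 14 → r' i = r i) : Ready D M r' := by
  constructor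
  · rw [he 4 (by norm_num) (by norm_num) (by norm_num), h.r4]
  · rw [he 5 (by norm_num) (by norm_num) (by norm_num), h.r5]
  · rw [he 6 (by norm_num) (by norm_num) (by norm_num), h.r6]
  · rw [he 7 (by norm_num) (by norm_num) (by norm_num), h.r7]
  · rw [he 8 (by norm_num) (by norm_num) (by norm_num), h.r8]
  · rw [he 9 (by norm_num) (by norm_num) (by norm_num), h.r9]
  · rw [he 14 (by norm_num) (by norm_num) (by norm_num), h.r14]

theorem Tables.Fits.n_le (hD : D.Fits b M k S J) : D.n ≤ S :=
  (Nat.le_mul_of_pos_right _ hD.K_pos).trans hD.ball_le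

theorem ends_candidate (hD : D.Fits b M k S J) (hmem : Holds D M k S mem) {i : ℕ} (hi : i < k)
    (hr : Ready D M r) (hx : r 10 < D.n) (hy : r 11 < D.n) {acc : ℕ} (hacc : acc ≤ M * D.inf)
    (h13 : r 13 = D.radius (r 11) + acc) :
    Ends b mem (.candidate (2 * k + 7) i) r (13 * J + 41)
      (fun r' => r' 2 = min (r 2) (D.cand (r 10) (r 11) acc i) ∧
        ∀ i < 15, i ≠ 2 → r' i = r i) := by
  have hS := hD.n_le
  have hsq := hD.sq_lt
  have hinf := hD.inf_lt
  rw [add_mul] at hinf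
  have hp := hD.pivot_lt _ hy
  have hu := hD.hub_lt _ hx i hi
  have hg := hD.hubDist_le _ hx i hi
  have hrad := hD.radius_le _ hy
  have hkey : D.pivot (r 11) * D.n + D.hub i (r 10) < D.n * D.n := by
    have := Nat.mul_le_mul_right D.n (Nat.succ_le_of_lt hp)
    rw [Nat.succ_mul] at this
    omega
  have hT : 13 * J + 41 = 5 + 1 + 5 + 1 + (13 * J + 19) + 5 + (2 + (1 + 2)) := by ring
  rw [hT]
  refine Ends.seq (Q₁ := fun r' => r' 16 = D.look (D.pivot (r 11) * D.n + D.hub i (r 10)) ∧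
      r' 17 = D.hubDist i (r 10) ∧ ∀ j < 15, r' j = r j)
    (Ends.seq (Q₁ := fun r' => r' 16 = D.look (D.pivot (r 11) * D.n + D.hub i (r 10)) ∧
        ∀ j < 15, r' j = r j)
      (Ends.seq
        (Q₁ := fun r' => r' 15 = D.pivot (r 11) * D.n + D.hub i (r 10) ∧ ∀ j < 15, r' j = r j)
        (Ends.seq (Q₁ := fun r' => r' 17 = D.hub i (r 10) ∧
            r' 16 = D.pivot (r 11) * D.n ∧ ∀ j < 16, r' j = r j)
          (Ends.seq (Q₁ := fun r' => r' 16 = D.pivot (r 11) * D.n ∧ ∀ j < 16, r' j = r j)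
            (Ends.seq (ends_fetch hD hmem (by norm_num) (by omega) (by omega))
              (fun r₁ h₁ => (ends_mul ?_).mono le_rfl ?_))
            (fun r₂ h₂ => ?_)) (fun r₃ h₃ => (ends_add ?_).mono le_rfl ?_)) (fun r₄ h₄ => ?_))
      (fun r₅ h₅ => ?_))
    (fun r₆ h₆ => Ends.seq (Q₁ := fun r' => r' 17 = D.cand (r 10) (r 11) acc i ∧
      ∀ j < 15, r' j = r j) ?_ (fun r₇ h₇ => Ends.ite (fun h => ?_) (fun h => ?_)))
  · rw [h₁.1, h₁.2 6 (by norm_num) (by norm_num), hr.r6]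
    change D.pivot (r 11) * D.n < _
    omega
  · rintro r₂ ⟨h2, h3⟩
    refine ⟨?_, fun j hj => ?_⟩
    · rw [h2, h₁.1, h₁.2 6 (by norm_num) (by norm_num), hr.r6]
      rfl
    · rw [h3 _ (by omega), h₁.2 _ (by omega) (by omega)]
  · obtain ⟨h2, h3⟩ := h₂
    have e10 := h3 10 (by norm_num)
    refine (ends_fetch hD hmem (by norm_num) (by omega) (by omega)).mono le_rfl ?_
    rintro r₃ ⟨h4, h5⟩
    refine ⟨?_, ?_, fun j hj => ?_⟩
    · rw [h4, e10]
      simp [Tables.entry]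
    · rw [h5 _ (by norm_num) (by norm_num), h2]
    · rw [h5 _ (by omega) (by omega), h3 _ (by omega)]
  · rw [h₃.1, h₃.2.1]; omega
  · rintro r₄ ⟨h4, h5⟩
    refine ⟨by rw [h4, h₃.1, h₃.2.1, add_comm], fun j hj => ?_⟩
    rw [h5 _ (by omega), h₃.2.2 _ (by omega)]
  · have e := h₄.2
    refine (ends_lookup hD hmem ?_ ?_ ?_).mono le_rfl ?_
    · rw [e _ (by norm_num), hr.r7]
    · rw [e _ (by norm_num), hr.r8]
    · rw [e _ (by norm_num), hr.r14]
    · rintro r' ⟨h5, h6⟩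
      refine ⟨?_, fun j hj => ?_⟩
      · rw [h5, h₄.1]
      · rw [h6 _ (by omega), e _ hj]
  · have e10 : r₅ 10 = r 10 := h₅.2 _ (by norm_num)
    refine (ends_fetch hD hmem (by norm_num) (by omega) (by omega)).mono le_rfl ?_
    rintro r₃ ⟨h4, h5⟩
    refine ⟨?_, ?_, fun j hj => ?_⟩
    · rw [h5 _ (by norm_num) (by norm_num), h₅.1]
    · rw [h4, e10]
      simp [Tables.entry, Nat.add_mod, show (2 * i + 1) / 2 = i by omega]
    · rw [h5 _ (by omega) (by omega), h₅.2 _ (by omega)]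
  · obtain ⟨h16, h17, hj⟩ := h₆
    have hlook := hD.look_le (D.pivot (r 11) * D.n + D.hub i (r 10))
    have e13 := hj 13 (by norm_num)
    apply Ends.block (by simp [Instr.Straight]) (by simp)
    refine ⟨?_, fun j hj' => ?_⟩
    · have e1 : (D.hubDist i (r 10) + D.look (D.pivot (r 11) * D.n + D.hub i (r 10))) % 2 ^ b = _ :=
        Nat.mod_eq_of_lt (by omega)
      have e2 : (D.hubDist i (r 10) + D.look (D.pivot (r 11) * D.n + D.hub i (r 10)) +
        (D.radius (r 11) + acc)) % 2 ^ b = _ := Nat.mod_eq_of_lt (by omega)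
      simp [regStep, h16, h17, e13, h13, e1, e2, Tables.cand]
    · simp only [regStep, List.foldl]
      rw [Function.update_of_ne (by omega), Function.update_of_ne (by omega), hj _ hj']
  · have h : r₇ 17 < r₇ 2 := h
    rw [h₇.1, h₇.2 2 (by norm_num)] at h
    refine (ends_copy (by rw [h₇.2 14 (by norm_num), hr.r14])).mono le_rfl ?_
    rintro r' ⟨h3, h4⟩
    refine ⟨by rw [h3, h₇.1, min_eq_right h.le], fun j hj hj' => ?_⟩
    rw [h4 j hj', h₇.2 j hj]
  · have h : r₇ 2 ≤ r₇ 17 := not_lt.1 h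
    rw [h₇.1, h₇.2 2 (by norm_num)] at h
    apply Ends.block (by simp) (by simp)
    refine ⟨by rw [min_eq_left h]; exact h₇.2 2 (by norm_num), fun j hj _ => h₇.2 j hj⟩

theorem ends_candidates (hD : D.Fits b M k S J) (hmem : Holds D M k S mem)
    (hr : Ready D M r) (hx : r 10 < D.n) (hy : r 11 < D.n) (hacc : r 12 ≤ M * D.inf) :
    Ends b mem (.candidates (2 * k + 7) k) r (k * (13 * J + 41) + 6)
      (fun r' => r' 2 = minUpto (D.cand (r 10) (r 11) (r 12)) (r 2) k ∧
        ∀ i < 15, i ≠ 2 → i ≠ 13 → r' i = r i) := by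
  have hS := hD.n_le
  have hrad := hD.radius_le _ hy
  have hinf := hD.inf_lt
  rw [add_mul] at hinf
  rw [show k * (13 * J + 41) + 6 = 5 + 1 + k * (13 * J + 41) by ring]
  let I : ℕ → (ℕ → ℕ) → Prop := fun j r' =>
    r' 2 = minUpto (D.cand (r 10) (r 11) (r 12)) (r 2) j ∧
      r' 13 = D.radius (r 11) + r 12 ∧ ∀ i < 15, i ≠ 2 → i ≠ 13 → r' i = r i
  refine Ends.seq (Q₁ := I 0) (Ends.seq (ends_fetch hD hmem (by norm_num) (by omega) (by omega))
    (fun r₁ h₁ => (ends_add ?_).mono le_rfl ?_)) (fun r₂ h₂ => ?_)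
  · rw [h₁.1, h₁.2 _ (by norm_num) (by norm_num)]
    change D.radius (r 11) + _ < _
    omega
  · rintro r₂ ⟨h2, h3⟩
    refine ⟨?_, ?_, fun i hi h2 h13 => ?_⟩
    · rw [h3 _ (by norm_num), h₁.2 _ (by norm_num) (by norm_num)]; rfl
    · rw [h2, h₁.1, h₁.2 _ (by norm_num) (by norm_num)]; rfl
    · rw [h3 _ h13, h₁.2 _ (by omega) h13]
  · refine (Ends.unroll (I := I) ?_ h₂).mono le_rfl fun r' h => ⟨h.1, h.2.2⟩
    rintro j hj r₃ ⟨h3, h4, h5⟩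
    have e10 := h5 10 (by norm_num) (by norm_num) (by norm_num)
    have e11 := h5 11 (by norm_num) (by norm_num) (by norm_num)
    refine (ends_candidate hD hmem hj (hr.congr fun i hi h h' => h5 i hi (by omega) (by omega))
      (by omega) (by omega) hacc (by rw [h4, e11])).mono le_rfl ?_
    rintro r₄ ⟨h6, h7⟩
    refine ⟨by rw [h6, e10, e11, h3]; rfl, by rw [h7 _ (by norm_num) (by norm_num), h4], ?_⟩
    intro i hi hi2 hi13
    rw [h7 i hi hi2, h5 i hi hi2 hi13]

theorem index_lt {n K x i : ℕ} (hx : x < n) (hi : i < K) : x * K + i < n * K := by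
  have := Nat.mul_le_mul_right K (Nat.succ_le_of_lt hx)
  rw [Nat.succ_mul] at this
  omega

theorem ends_move (hD : D.Fits b M k S J) (hmem : Holds D M k S mem)
    (hr : Ready D M r) (hx : r 10 < D.n) (hy : r 11 < D.n) (hacc : r 12 + D.inf < 2 ^ b)
    (he : r 13 < 2 ^ b) :
    Ends b mem (.move (2 * k + 7)) r 20
      (fun r' => (r' 10, r' 11, r' 12, r' 13) = D.move (r 10, r 11, r 12, r 13) ∧
        ∀ i < 15, i < 10 ∨ i = 14 → r' i = r i) := by
  have hK := hD.K_pos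
  have hB := hD.ball_le
  have hSX : S < 2 ^ b := by
    have := hD.size_le
    have := hD.seven_le
    nlinarith
  have hdiv : r 13 / (2 * D.K) * (2 * D.K) ≤ r 13 := Nat.div_mul_le_self _ _
  have hmod : r 13 - r 13 / (2 * D.K) * (2 * D.K) = r 13 % (2 * D.K) := by
    have := Nat.div_add_mod' (r 13) (2 * D.K)
    omega
  have hlt : r 13 % (2 * D.K) < 2 * D.K := Nat.mod_lt _ (by omega)
  rw [show 20 = 4 + (14 + 2) from rfl]
  refine Ends.seq (Q₁ := fun r' => r' 15 = r 13 % (2 * D.K) ∧ r' 13 = r 13 / (2 * D.K) ∧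
    ∀ i < 15, i ≠ 13 → r' i = r i) ?_ (fun r₁ h₁ => Ends.ite (fun h => ?_) (fun h => ?_))
  · apply Ends.block (by simp [Instr.Straight]) (by simp)
    have e1 : r 13 / (2 * D.K) * (2 * D.K) % 2 ^ b = _ := Nat.mod_eq_of_lt (by omega)
    refine ⟨?_, ?_, fun i hi h13 => ?_⟩
    · simp [regStep, hr.r9, hr.r14, e1, hmod]
    · simp [regStep, hr.r9, hr.r14]
    · have : i ≠ 15 := by omega
      have : i ≠ 16 := by omega
      have : i ≠ 17 := by omega
      simp [regStep, Function.update_of_ne, *]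
  all_goals
    obtain ⟨h15, h13, hj⟩ := h₁
    have e5 := hj 5 (by norm_num) (by norm_num)
    have e10 := hj 10 (by norm_num) (by norm_num)
    have e11 := hj 11 (by norm_num) (by norm_num)
    have e12 := hj 12 (by norm_num) (by norm_num)
    rw [hr.r5] at e5
  · have h : r₁ 15 < r₁ 5 := h
    rw [h15, e5] at h
    have hidx := index_lt hx h
    have hd := hD.ballDist_le _ hidx
    have hdn := hD.ballVertex_lt _ hidx
    refine Ends.mono (T₁ := 2 + 5 + 5 + 1) (Ends.seq
      (Q₁ := fun r' => r' 10 = D.ballVertex (r 10 * D.K + r 13 % (2 * D.K)) ∧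
        r' 17 = D.ballDist (r 10 * D.K + r 13 % (2 * D.K)) ∧ r' 13 = r 13 / (2 * D.K) ∧
        ∀ i < 15, i ≠ 10 → i ≠ 13 → r' i = r i)
      (Ends.seq
        (Q₁ := fun r' => r' 10 = D.ballVertex (r 10 * D.K + r 13 % (2 * D.K)) ∧
          r' 16 = r 10 * D.K + r 13 % (2 * D.K) ∧ r' 13 = r 13 / (2 * D.K) ∧
          ∀ i < 15, i ≠ 10 → i ≠ 13 → r' i = r i)
        (Ends.seq
          (Q₁ := fun r' => r' 16 = r 10 * D.K + r 13 % (2 * D.K) ∧ r' 13 = r 13 / (2 * D.K) ∧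
            ∀ i < 15, i ≠ 13 → r' i = r i) ?_ (fun r₂ h₂ => ?_)) (fun r₃ h₃ => ?_))
      (fun r₄ h₄ => (ends_add ?_).mono le_rfl ?_)) (by norm_num) (fun _ h => h)
    · apply Ends.block (by simp [Instr.Straight]) (by simp)
      have e1 : r 10 * D.K % 2 ^ b = _ := Nat.mod_eq_of_lt (by omega)
      have e2 : (r 10 * D.K + r 13 % (2 * D.K)) % 2 ^ b = _ := Nat.mod_eq_of_lt (by omega)
      refine ⟨?_, ?_, fun i hi h13 => ?_⟩
      · simp [regStep, e5, e10, e1, h15, e2]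
      · simp [regStep, h13]
      · have : i ≠ 16 := by omega
        simp [regStep, Function.update_of_ne, *]
    · refine (ends_fetch hD hmem (by norm_num) (by omega) (by rw [h₂.1]; omega)).mono le_rfl ?_
      rintro r₃ ⟨h3, h4⟩
      refine ⟨by rw [h3, h₂.1]; rfl, by rw [h4 _ (by norm_num) (by norm_num), h₂.1],
        by rw [h4 _ (by norm_num) (by norm_num), h₂.2.1], fun i hi hi10 hi13 => ?_⟩
      rw [h4 _ (by omega) hi10, h₂.2.2 i hi hi13]
    · refine (ends_fetch hD hmem (by norm_num) (by omega) (by rw [h₃.2.1]; omega)).mono le_rfl ?_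
      rintro r₄ ⟨h3, h4⟩
      refine ⟨by rw [h4 _ (by norm_num) (by norm_num), h₃.1], by rw [h3, h₃.2.1]; rfl,
        by rw [h4 _ (by norm_num) (by norm_num), h₃.2.2.1], fun i hi hi10 hi13 => ?_⟩
      rw [h4 _ (by omega) (by omega), h₃.2.2.2 i hi hi10 hi13]
    · rw [h₄.2.1, h₄.2.2.2 12 (by norm_num) (by norm_num) (by norm_num)]; omega
    · rintro r₅ ⟨h5, h6⟩
      refine ⟨?_, fun i hi h => ?_⟩
      · rw [Tables.move, if_pos h, h6 10 (by norm_num), h6 11 (by norm_num), h5,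
          h6 13 (by norm_num), h₄.1, h₄.2.1, h₄.2.2.1,
          h₄.2.2.2 11 (by norm_num) (by norm_num) (by norm_num),
          h₄.2.2.2 12 (by norm_num) (by norm_num) (by norm_num)]
      · rw [h6 i (by omega), h₄.2.2.2 i hi (by omega) (by omega)]
  · have h : ¬ r₁ 15 < r₁ 5 := h
    rw [h15, e5] at h
    have hidx := index_lt hy (show r 13 % (2 * D.K) - D.K < D.K by omega)
    have hd := hD.ballDist_le _ hidx
    have hdn := hD.ballVertex_lt _ hidx
    refine Ends.mono (T₁ := 3 + 5 + 5 + 1) (Ends.seq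
      (Q₁ := fun r' => r' 11 = D.ballVertex (r 11 * D.K + (r 13 % (2 * D.K) - D.K)) ∧
        r' 17 = D.ballDist (r 11 * D.K + (r 13 % (2 * D.K) - D.K)) ∧ r' 13 = r 13 / (2 * D.K) ∧
        ∀ i < 15, i ≠ 11 → i ≠ 13 → r' i = r i)
      (Ends.seq
        (Q₁ := fun r' => r' 11 = D.ballVertex (r 11 * D.K + (r 13 % (2 * D.K) - D.K)) ∧
          r' 16 = r 11 * D.K + (r 13 % (2 * D.K) - D.K) ∧ r' 13 = r 13 / (2 * D.K) ∧
          ∀ i < 15, i ≠ 11 → i ≠ 13 → r' i = r i)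
        (Ends.seq
          (Q₁ := fun r' => r' 16 = r 11 * D.K + (r 13 % (2 * D.K) - D.K) ∧
            r' 13 = r 13 / (2 * D.K) ∧
            ∀ i < 15, i ≠ 13 → r' i = r i) ?_ (fun r₂ h₂ => ?_)) (fun r₃ h₃ => ?_))
      (fun r₄ h₄ => (ends_add ?_).mono le_rfl ?_)) (by norm_num) (fun _ h => h)
    · apply Ends.block (by simp [Instr.Straight]) (by simp)
      have e1 : r 11 * D.K % 2 ^ b = _ := Nat.mod_eq_of_lt (by omega)
      have e2 : (r 11 * D.K + (r 13 % (2 * D.K) - D.K)) % 2 ^ b = _ := Nat.mod_eq_of_lt (by omega)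
      refine ⟨?_, ?_, fun i hi h13 => ?_⟩
      · simp [regStep, e5, e11, e1, h15, e2]
      · simp [regStep, h13]
      · have : i ≠ 15 := by omega
        have : i ≠ 16 := by omega
        simp [regStep, Function.update_of_ne, *]
    · refine (ends_fetch hD hmem (by norm_num) (by omega) (by rw [h₂.1]; omega)).mono le_rfl ?_
      rintro r₃ ⟨h3, h4⟩
      refine ⟨by rw [h3, h₂.1]; rfl, by rw [h4 _ (by norm_num) (by norm_num), h₂.1],
        by rw [h4 _ (by norm_num) (by norm_num), h₂.2.1], fun i hi hi10 hi13 => ?_⟩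
      rw [h4 _ (by omega) hi10, h₂.2.2 i hi hi13]
    · refine (ends_fetch hD hmem (by norm_num) (by omega) (by rw [h₃.2.1]; omega)).mono le_rfl ?_
      rintro r₄ ⟨h3, h4⟩
      refine ⟨by rw [h4 _ (by norm_num) (by norm_num), h₃.1], by rw [h3, h₃.2.1]; rfl,
        by rw [h4 _ (by norm_num) (by norm_num), h₃.2.2.1], fun i hi hi10 hi13 => ?_⟩
      rw [h4 _ (by omega) (by omega), h₃.2.2.2 i hi hi10 hi13]
    · rw [h₄.2.1, h₄.2.2.2 12 (by norm_num) (by norm_num) (by norm_num)]; omega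
    · rintro r₅ ⟨h5, h6⟩
      refine ⟨?_, fun i hi h => ?_⟩
      · rw [Tables.move, if_neg h, h6 10 (by norm_num), h6 11 (by norm_num), h5,
          h6 13 (by norm_num), h₄.1, h₄.2.1, h₄.2.2.1,
          h₄.2.2.2 10 (by norm_num) (by norm_num) (by norm_num),
          h₄.2.2.2 12 (by norm_num) (by norm_num) (by norm_num)]
      · rw [h6 i (by omega), h₄.2.2.2 i hi (by omega) (by omega)]

theorem Tables.Fits.move (hD : D.Fits b M k S J) {z : ℕ × ℕ × ℕ × ℕ} (hx : z.1 < D.n)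
    (hy : z.2.1 < D.n) : (D.move z).1 < D.n ∧ (D.move z).2.1 < D.n ∧
      (D.move z).2.2.1 ≤ z.2.2.1 + D.inf ∧ (D.move z).2.2.2 ≤ z.2.2.2 := by
  have hK := hD.K_pos
  have hlt : z.2.2.2 % (2 * D.K) < 2 * D.K := Nat.mod_lt _ (by omega)
  unfold Tables.move
  split_ifs with h
  · have hi := index_lt hx h
    exact ⟨hD.ballVertex_lt _ hi, hy, Nat.add_le_add_left (hD.ballDist_le _ hi) _,
      Nat.div_le_self _ _⟩
  · have hi := index_lt hy (show z.2.2.2 % (2 * D.K) - D.K < D.K by omega)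
    exact ⟨hx, hD.ballVertex_lt _ hi, Nat.add_le_add_left (hD.ballDist_le _ hi) _,
      Nat.div_le_self _ _⟩

theorem Tables.Fits.iterate_move (hD : D.Fits b M k S J) {s t e : ℕ} (hs : s < D.n)
    (ht : t < D.n) (j : ℕ) : (D.move^[j] (s, t, 0, e)).1 < D.n ∧
      (D.move^[j] (s, t, 0, e)).2.1 < D.n ∧ (D.move^[j] (s, t, 0, e)).2.2.1 ≤ j * D.inf ∧
      (D.move^[j] (s, t, 0, e)).2.2.2 ≤ e := by
  induction j with
  | zero => simp [hs, ht]
  | succ j ih =>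
    rw [Function.iterate_succ_apply']
    obtain ⟨h1, h2, h3, h4⟩ := hD.move ih.1 ih.2.1
    exact ⟨h1, h2, by rw [Nat.succ_mul]; omega, h4.trans ih.2.2.2⟩

theorem ends_improve (hD : D.Fits b M k S J) (hmem : Holds D M k S mem)
    (hr : Ready D M r) (hs : r 0 < D.n) (ht : r 1 < D.n) (he : r 3 < (2 * D.K) ^ M) :
    Ends b mem (.improve (2 * k + 7) M k) r (20 * M + 2 * k * (13 * J + 41) + 26)
      (fun r' => r' 2 = D.improve M k (r 0) (r 1) (r 3) (r 2) ∧ r' 3 = r 3 + 1 ∧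
        ∀ i < 15, i < 10 ∨ i = 14 → i ≠ 2 → i ≠ 3 → r' i = r i) := by
  have hcodes := hD.codes_lt
  have hinf := hD.inf_lt
  rw [add_mul] at hinf
  obtain ⟨hxM, hyM, haccM, -⟩ := hD.iterate_move (e := r 3) hs ht M
  set z := D.move^[M] (r 0, r 1, 0, r 3) with hz
  let I : ℕ → (ℕ → ℕ) → Prop := fun j r' =>
    (r' 10, r' 11, r' 12, r' 13) = D.move^[j] (r 0, r 1, 0, r 3) ∧
      ∀ i < 15, i < 10 ∨ i = 14 → r' i = r i
  let A : (ℕ → ℕ) → Prop := fun r' => r' 10 = z.1 ∧ r' 11 = z.2.1 ∧ r' 12 = z.2.2.1 ∧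
    ∀ i < 15, i < 10 ∨ i = 14 → i ≠ 2 → r' i = r i
  let A' : (ℕ → ℕ) → Prop := fun r' => r' 11 = z.1 ∧ r' 10 = z.2.1 ∧ r' 12 = z.2.2.1 ∧
    ∀ i < 15, i < 10 ∨ i = 14 → i ≠ 2 → r' i = r i
  let a₀ := if z.1 = z.2.1 then min (r 2) z.2.2.1 else r 2
  let a₁ := minUpto (D.cand z.1 z.2.1 z.2.2.1) a₀ k
  let a₂ := minUpto (D.cand z.2.1 z.1 z.2.2.1) a₁ k
  rw [show 20 * M + 2 * k * (13 * J + 41) + 26 = 4 + M * 20 + (1 + 2 + 2) +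
    (k * (13 * J + 41) + 6) + 3 + (k * (13 * J + 41) + 6) + 2 by ring]
  refine Ends.seq (Q₁ := fun r' => A' r' ∧ r' 2 = a₂)
    (Ends.seq (Q₁ := fun r' => A' r' ∧ r' 2 = a₁)
      (Ends.seq (Q₁ := fun r' => A r' ∧ r' 2 = a₁)
        (Ends.seq (Q₁ := fun r' => A r' ∧ r' 2 = a₀)
          (Ends.seq (Q₁ := I M)
            (Ends.seq (Q₁ := I 0) ?_ (fun r₁ h₁ => Ends.unroll (I := I) ?_ h₁))
            (fun r₁ h₁ => ?_)) (fun r₁ h₁ => ?_)) (fun r₁ h₁ => ?_)) (fun r₁ h₁ => ?_))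
    (fun r₁ h₁ => ?_)
  · apply Ends.block (by simp [Instr.Straight]) (by simp)
    refine ⟨by simp [regStep, hr.r14], fun i hi h => ?_⟩
    have : i ≠ 10 := by omega
    have : i ≠ 11 := by omega
    have : i ≠ 12 := by omega
    have : i ≠ 13 := by omega
    simp [regStep, Function.update_of_ne, *]
  · rintro j hj r' ⟨h, hi⟩
    obtain ⟨h1, h2, h3, h4⟩ := hD.iterate_move (e := r 3) hs ht j
    rw [← h] at h1 h2 h3 h4
    simp only at h1 h2 h3 h4
    have : j * D.inf ≤ M * D.inf := Nat.mul_le_mul_right _ hj.le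
    refine (ends_move hD hmem (hr.congr fun i h15 _ h => hi i h15 h) h1 h2 (by omega)
      (by omega)).mono le_rfl ?_
    rintro r'' ⟨h', hi'⟩
    refine ⟨by rw [h', h, Function.iterate_succ_apply'], fun i h15 h => ?_⟩
    rw [hi' i h15 h, hi i h15 h]
  · obtain ⟨h, hi⟩ := h₁
    rw [← hz] at h
    have e1 : r₁ 10 = z.1 := by rw [← h]
    have e2 : r₁ 11 = z.2.1 := by rw [← h]
    have e3 : r₁ 12 = z.2.2.1 := by rw [← h]
    have hi2 := hi 2 (by norm_num) (by norm_num)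
    refine Ends.ite (fun hc => Ends.ite (fun hc' => ?_) (fun hc' => ?_)) (fun hc => ?_)
    · have hc : r₁ 10 = r₁ 11 := hc
      have hc' : r₁ 12 < r₁ 2 := hc'
      refine (ends_copy (by rw [hi 14 (by norm_num) (by norm_num), hr.r14])).mono le_rfl ?_
      rintro r' ⟨h5, h6⟩
      refine ⟨⟨?_, ?_, ?_, fun i h15 h h2 => ?_⟩, ?_⟩
      · rw [h6 _ (by norm_num), e1]
      · rw [h6 _ (by norm_num), e2]
      · rw [h6 _ (by norm_num), e3]
      · rw [h6 _ h2, hi i h15 h]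
      · rw [h5, e3]
        simp only [a₀]
        rw [if_pos (by omega), min_eq_right (by omega)]
    · have hc : r₁ 10 = r₁ 11 := hc
      have hc' : r₁ 2 ≤ r₁ 12 := not_lt.1 hc'
      apply Ends.block (by simp) (by simp)
      refine ⟨⟨e1, e2, e3, fun i h15 h h2 => hi i h15 h⟩, ?_⟩
      simp only [List.foldl, a₀]
      rw [if_pos (by omega), min_eq_left (by omega), hi2]
    · have hc : r₁ 10 ≠ r₁ 11 := hc
      apply Ends.block (by simp) (by simp)
      refine ⟨⟨e1, e2, e3, fun i h15 h h2 => hi i h15 h⟩, ?_⟩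
      simp only [List.foldl, a₀]
      rw [if_neg (by omega), hi2]
  · obtain ⟨⟨e1, e2, e3, hi⟩, h2⟩ := h₁
    refine (ends_candidates hD hmem
      (hr.congr fun i h15 h h' => hi i h15 h' (by omega)) (by omega) (by omega)
        (by omega)).mono le_rfl ?_
    rintro r' ⟨h3, h4⟩
    refine ⟨⟨?_, ?_, ?_, fun i h15 h h2 => ?_⟩, ?_⟩
    · rw [h4 _ (by norm_num) (by norm_num) (by norm_num), e1]
    · rw [h4 _ (by norm_num) (by norm_num) (by norm_num), e2]
    · rw [h4 _ (by norm_num) (by norm_num) (by norm_num), e3]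
    · rw [h4 i h15 h2 (by omega), hi i h15 h h2]
    · rw [h3, e1, e2, e3, h2]
  · obtain ⟨⟨e1, e2, e3, hi⟩, h2⟩ := h₁
    have e14 : r₁ 14 = 0 := by rw [hi 14 (by norm_num) (by norm_num) (by norm_num), hr.r14]
    apply Ends.block (by simp [Instr.Straight]) (by simp)
    refine ⟨⟨?_, ?_, ?_, fun i h15 h h2 => ?_⟩, ?_⟩
    · simp [regStep, e14, e1]
    · simp [regStep, e14, e2]
    · simp [regStep, e3]
    · have : i ≠ 10 := by omega
      have : i ≠ 11 := by omega
      have : i ≠ 16 := by omega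
      simp [regStep, Function.update_of_ne, *]
    · simp [regStep, h2]
  · obtain ⟨⟨e1, e2, e3, hi⟩, h2⟩ := h₁
    refine (ends_candidates hD hmem
      (hr.congr fun i h15 h h' => hi i h15 h' (by omega)) (by omega) (by omega)
        (by omega)).mono le_rfl ?_
    rintro r' ⟨h3, h4⟩
    refine ⟨⟨?_, ?_, ?_, fun i h15 h h2 => ?_⟩, ?_⟩
    · rw [h4 _ (by norm_num) (by norm_num) (by norm_num), e1]
    · rw [h4 _ (by norm_num) (by norm_num) (by norm_num), e2]
    · rw [h4 _ (by norm_num) (by norm_num) (by norm_num), e3]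
    · rw [h4 i h15 h2 (by omega), hi i h15 h h2]
    · rw [h3, e1, e2, e3, h2]
  · obtain ⟨⟨e1, e2, e3, hi⟩, h2⟩ := h₁
    have h3 := hi 3 (by norm_num) (by norm_num) (by norm_num)
    have c1 : 1 % 2 ^ b = 1 := Nat.mod_eq_of_lt (by have := hD.two_lt; omega)
    have c2 : (r 3 + 1) % 2 ^ b = r 3 + 1 := Nat.mod_eq_of_lt (by omega)
    apply Ends.block (by simp [Instr.Straight]) (by simp)
    refine ⟨?_, ?_, fun i h15 h hi2 hi3 => ?_⟩
    · simp [regStep, h2, a₂, a₁, a₀, Tables.improve, ← hz]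
    · simp [regStep, h3, c1, c2]
    · have : i ≠ 16 := by omega
      simp [regStep, Function.update_of_ne, *]

theorem ends_readHeader (hD : D.Fits b M k S J) (hmem : Holds D M k S mem) (h14 : r 14 = 0) :
    Ends b mem (.readHeader (2 * k + 7)) r 36
      (fun r' => Ready D M r' ∧ ∀ i < 4, r' i = r i) := by
  have hS := hD.seven_le
  have h7 : 7 < 2 ^ b := by
    have := Nat.mul_le_mul (show 7 ≤ 2 * k + 7 by omega) hS
    have := hD.size_le
    omega
  let I : ℕ → (ℕ → ℕ) → Prop := fun j r' =>
    (∀ i < j, r' (i + 4) = D.header M i) ∧ ∀ i < 15, i < 4 ∨ i = 14 → r' i = r i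
  refine (Ends.unroll (I := I) (m := 6) (T := 6) ?_ ⟨by simp, by simp⟩).mono le_rfl ?_
  · rintro j hj r' ⟨h1, h2⟩
    rw [show 6 = 1 + 5 from rfl]
    refine Ends.seq (Q₁ := fun r₁ => r₁ 16 = j ∧ ∀ i < 15, r₁ i = r' i) ?_ (fun r₁ h₁ => ?_)
    · apply Ends.block (by simp [Instr.Straight]) (by simp)
      refine ⟨?_, fun i hi => ?_⟩
      · simp [regStep, Nat.mod_eq_of_lt (show j < 2 ^ b by omega)]
      · have : i ≠ 16 := by omega
        simp [regStep, Function.update_of_ne, *]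
    · obtain ⟨h3, h4⟩ := h₁
      refine (ends_fetch hD hmem (by norm_num) (by omega) (by omega)).mono le_rfl ?_
      rintro r₂ ⟨h5, h6⟩
      refine ⟨fun i hi => ?_, fun i hi h => ?_⟩
      · rcases eq_or_ne i j with rfl | hij
        · rw [h5, h3]; rfl
        · rw [h6 _ (by omega) (by omega), h4 _ (by omega), h1 i (by omega)]
      · rw [h6 _ (by omega) (by omega), h4 _ hi, h2 i hi h]
  · rintro r' ⟨h1, h2⟩
    exact ⟨⟨h1 0 (by norm_num), h1 1 (by norm_num), h1 2 (by norm_num), h1 3 (by norm_num),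
      h1 4 (by norm_num), h1 5 (by norm_num), by rw [h2 14 (by norm_num) (by norm_num), h14]⟩,
      fun i hi => h2 i (by omega) (by omega)⟩

theorem ends_query (hD : D.Fits b M k S J) (hmem : Holds D M k S mem) (hs : r 0 < D.n)
    (ht : r 1 < D.n) (h3 : r 3 = 0) (h14 : r 14 = 0) :
    Ends b mem (.query M k) r
      ((2 * D.K) ^ M * (20 * M + 2 * k * (13 * J + 41) + 28) + 48)
      (fun r' => if D.best M k (r 0) (r 1) ((2 * D.K) ^ M) < D.inf then
        r' 0 = D.best M k (r 0) (r 1) ((2 * D.K) ^ M) ∧ r' 1 = D.scale else r' 1 = 0) := by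
  have hS := hD.seven_le
  have h7 : 7 < 2 ^ b := by
    have := Nat.mul_le_mul (show 7 ≤ 2 * k + 7 by omega) hS
    have := hD.size_le
    omega
  let I : ℕ → (ℕ → ℕ) → Prop := fun j r' => r' 2 = D.best M k (r 0) (r 1) (r' 3) ∧
    r' 3 + j = (2 * D.K) ^ M ∧ r' 0 = r 0 ∧ r' 1 = r 1 ∧ Ready D M r'
  rw [show (2 * D.K) ^ M * (20 * M + 2 * k * (13 * J + 41) + 28) + 48 = 36 + 1 +
    ((2 * D.K) ^ M * (20 * M + 2 * k * (13 * J + 41) + 26 + 2) + 2) + (7 + 2) by ring]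
  refine Ends.seq (Ends.seq (Q₁ := I ((2 * D.K) ^ M))
    (Ends.seq (ends_readHeader hD hmem h14) (fun r₁ h₁ => (ends_copy h₁.1.r14).mono le_rfl ?_))
      (fun r₁ h₁ => Ends.loop (I := I) ?_ ?_ h₁)) (fun r₁ h₁ => ?_)
  · rintro r' ⟨h4, h5⟩
    have e3 : r' 3 = 0 := by rw [h5 3 (by norm_num), h₁.2 3 (by norm_num), h3]
    refine ⟨?_, ?_, ?_, ?_, h₁.1.congr fun i _ h _ => h5 i (by omega)⟩
    · rw [h4, e3, h₁.1.r8]; rfl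
    · rw [e3, zero_add]
    · rw [h5 0 (by norm_num), h₁.2 0 (by norm_num)]
    · rw [h5 1 (by norm_num), h₁.2 1 (by norm_num)]
  · rintro j r' ⟨h4, h5, h6, h7, h8⟩ _
    refine (ends_improve hD hmem h8 (by omega) (by omega) (by omega)).mono le_rfl ?_
    rintro r₂ ⟨h9, h10, h11⟩
    refine ⟨?_, by omega, ?_, ?_, h8.congr fun i hi h h' => h11 i hi h' (by omega) (by omega)⟩
    · rw [h9, h10, h4, h6, h7]; rfl
    · rw [h11 0 (by norm_num) (by norm_num) (by norm_num) (by norm_num), h6]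
    · rw [h11 1 (by norm_num) (by norm_num) (by norm_num) (by norm_num), h7]
  · rintro r' ⟨h4, h5, h6, h7, h8⟩ ht
    have ht : r' 3 < r' 4 := ht
    rw [h8.r4] at ht
    omega
  · obtain ⟨j, ⟨h4, h5, h6, _, h8⟩, ht⟩ := h₁
    have ht : ¬ r₁ 3 < r₁ 4 := ht
    rw [h8.r4] at ht
    have e3 : r₁ 3 = (2 * D.K) ^ M := by omega
    rw [e3] at h4
    refine Ends.ite (fun hc => ?_) (fun hc => ?_)
    · have hc : r₁ 2 < r₁ 8 := hc
      rw [h4, h8.r8] at hc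
      simp only [if_pos hc]
      refine Ends.seq (T₁ := 1 + 5) (T₂ := 1) (Q₁ := fun r' => r' 1 = D.scale ∧
        ∀ i < 15, i ≠ 1 → r' i = r₁ i) (Ends.seq (Q₁ := fun r' => r' 16 = 6 ∧
        ∀ i < 15, r' i = r₁ i) ?_ (fun r₂ h₂ => ?_)) (fun r₂ h₂ => ?_)
      · apply Ends.block (by simp [Instr.Straight]) (by simp)
        refine ⟨?_, fun i hi => ?_⟩
        · simp [regStep, Nat.mod_eq_of_lt (show 6 < 2 ^ b by omega)]
        · have : i ≠ 16 := by omega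
          simp [regStep, Function.update_of_ne, *]
      · refine (ends_fetch hD hmem (by norm_num) (by omega) (by omega)).mono le_rfl ?_
        rintro r₃ ⟨h9, h10⟩
        refine ⟨by rw [h9, h₂.1]; rfl, fun i hi h => ?_⟩
        rw [h10 i (by omega) h, h₂.2 i hi]
      · refine (ends_copy (by rw [h₂.2 14 (by norm_num) (by norm_num), h8.r14])).mono le_rfl ?_
        rintro r₃ ⟨h9, h10⟩
        exact ⟨by rw [h9, h₂.2 2 (by norm_num) (by norm_num), h4],
          by rw [h10 1 (by norm_num), h₂.1]⟩
    · have hc : ¬ r₁ 2 < r₁ 8 := hc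
      rw [h4, h8.r8] at hc
      simp only [if_neg hc]
      apply Ends.block (by simp [Instr.Straight]) (by simp)
      simp [regStep]

/-- The words of the memory that holds the tables. -/
def Tables.words (D : Tables) (M k S : ℕ) : List ℕ :=
  (List.range ((2 * k + 7) * S)).map fun a => D.entry M (a % (2 * k + 7)) (a / (2 * k + 7))

theorem Tables.holds_words (D : Tables) (M k S : ℕ) :
    Holds D M k S (fun a => (D.words M k S).getD a 0) := by
  intro j hj i hi
  have h : (2 * k + 7) * i + j < (2 * k + 7) * S := by
    have := Nat.mul_le_mul_left (2 * k + 7) (Nat.succ_le_of_lt hi)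
    rw [Nat.mul_succ] at this
    omega
  have h1 : ((2 * k + 7) * i + j) / (2 * k + 7) = i := by
    rw [Nat.mul_add_div (by omega), Nat.div_eq_of_lt hj, add_zero]
  simp only [Tables.words]
  rw [List.getD_eq_getElem _ _ (by simpa using h)]
  simp [h1, Nat.mod_eq_of_lt hj]

theorem Tables.Fits.query (hD : D.Fits b M k S J) {s t : ℕ} (hs : s < D.n) (ht : t < D.n) :
    ∃ τ ≤ (2 * D.K) ^ M * (20 * M + 2 * k * (13 * J + 41) + 28) + 48, ∃ σ : State,
      (step b (Code.query M k 0))^[τ] (init (D.words M k S) s t) = σ ∧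
        Halted (Code.query M k 0) σ ∧
        if D.best M k s t ((2 * D.K) ^ M) < D.inf then
          σ.reg 0 = D.best M k s t ((2 * D.K) ^ M) ∧ σ.reg 1 = D.scale else σ.reg 1 = 0 := by
  obtain ⟨τ, hτ, r', hr, hq⟩ := ends_query hD (D.holds_words M k S)
    (r := (init (D.words M k S) s t).reg) hs ht rfl rfl
  exact ⟨τ, hτ, _, hr _ 0 (fun i _ => by rw [zero_add]), (zero_add _).ge, hq⟩

/-! ### The value of the query -/

theorem minUpto_le_left (f : ℕ → ℕ) (a j : ℕ) : minUpto f a j ≤ a := by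
  induction j with
  | zero => exact le_rfl
  | succ j ih => exact (min_le_left _ _).trans ih

theorem minUpto_le (f : ℕ → ℕ) (a : ℕ) {i j : ℕ} (h : i < j) : minUpto f a j ≤ f i := by
  induction j with
  | zero => omega
  | succ j ih =>
    rcases Nat.lt_succ_iff_lt_or_eq.1 h with h | rfl
    · exact (min_le_left _ _).trans (ih h)
    · exact min_le_right _ _

theorem le_minUpto {f : ℕ → ℕ} {a j δ : ℕ} (ha : δ ≤ a) (hf : ∀ i < j, δ ≤ f i) :
    δ ≤ minUpto f a j := by
  induction j with
  | zero => exact ha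
  | succ j ih => exact le_min (ih fun i hi => hf i (by omega)) (hf j (by omega))

/-- Since `improve` never exceeds its last argument, what is gained at the code `e` is kept by all
later codes. -/
theorem Tables.best_le_improve (D : Tables) (M k s t : ℕ) {e m : ℕ} (h : e < m) :
    ∃ a, D.best M k s t m ≤ D.improve M k s t e a := by
  induction m with
  | zero => omega
  | succ m ih =>
    rcases Nat.lt_succ_iff_lt_or_eq.1 h with h | rfl
    · obtain ⟨a, ha⟩ := ih h
      refine ⟨a, le_trans ((minUpto_le_left _ _ _).trans ((minUpto_le_left _ _ _).trans ?_)) ha⟩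
      split_ifs
      · exact min_le_left _ _
      · exact le_rfl
    · exact ⟨_, le_rfl⟩

theorem Tables.best_le_of_eq (D : Tables) (M k s t : ℕ) {e m : ℕ} (h : e < m)
    (hz : (D.move^[M] (s, t, 0, e)).1 = (D.move^[M] (s, t, 0, e)).2.1) :
    D.best M k s t m ≤ (D.move^[M] (s, t, 0, e)).2.2.1 := by
  obtain ⟨a, ha⟩ := D.best_le_improve M k s t h
  refine ha.trans ((minUpto_le_left _ _ _).trans ((minUpto_le_left _ _ _).trans ?_))
  rw [if_pos hz]
  exact min_le_right _ _

theorem Tables.best_le_cand (D : Tables) (M k s t : ℕ) {e m i : ℕ} (h : e < m) (hi : i < k) :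
    D.best M k s t m ≤ D.cand (D.move^[M] (s, t, 0, e)).1 (D.move^[M] (s, t, 0, e)).2.1
      (D.move^[M] (s, t, 0, e)).2.2.1 i := by
  obtain ⟨a, ha⟩ := D.best_le_improve M k s t h
  exact ha.trans ((minUpto_le_left _ _ _).trans (minUpto_le _ _ hi))

theorem Tables.best_le_cand_swap (D : Tables) (M k s t : ℕ) {e m i : ℕ} (h : e < m)
    (hi : i < k) :
    D.best M k s t m ≤ D.cand (D.move^[M] (s, t, 0, e)).2.1 (D.move^[M] (s, t, 0, e)).1
      (D.move^[M] (s, t, 0, e)).2.2.1 i := by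
  obtain ⟨a, ha⟩ := D.best_le_improve M k s t h
  exact ha.trans (minUpto_le _ _ hi)

theorem Tables.le_best (D : Tables) {M k s t δ : ℕ} (hinf : δ ≤ D.inf)
    (heq : ∀ e, (D.move^[M] (s, t, 0, e)).1 = (D.move^[M] (s, t, 0, e)).2.1 →
      δ ≤ (D.move^[M] (s, t, 0, e)).2.2.1)
    (hcand : ∀ e, ∀ i < k, δ ≤ D.cand (D.move^[M] (s, t, 0, e)).1
      (D.move^[M] (s, t, 0, e)).2.1 (D.move^[M] (s, t, 0, e)).2.2.1 i)
    (hcand' : ∀ e, ∀ i < k, δ ≤ D.cand (D.move^[M] (s, t, 0, e)).2.1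
      (D.move^[M] (s, t, 0, e)).1 (D.move^[M] (s, t, 0, e)).2.2.1 i) (m : ℕ) :
    δ ≤ D.best M k s t m := by
  induction m with
  | zero => exact hinf
  | succ m ih =>
    refine le_minUpto (le_minUpto ?_ (hcand m)) (hcand' m)
    split_ifs with h
    · exact le_min ih (heq m h)
    · exact ih

end WordRAM

/-! ### Near sets and hitting sets -/

theorem Finset.exists_nearest {V : Type*} [DecidableEq V] (A : Finset V) (f : V → ℕ) {K : ℕ}
    (hK : K ≤ A.card) :
    ∃ S ⊆ A, S.card = K ∧ ∀ a ∈ S, ∀ b ∈ A, b ∉ S → f a ≤ f b := by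
  induction K with
  | zero => exact ⟨∅, by simp, rfl, by simp⟩
  | succ K ih =>
    obtain ⟨S, hSA, hS, h⟩ := ih (by omega)
    have hne : (A \ S).Nonempty := by
      rw [← Finset.card_pos, Finset.card_sdiff_of_subset hSA]; omega
    obtain ⟨c, hc, hmin⟩ := Finset.exists_min_image _ f hne
    rw [Finset.mem_sdiff] at hc
    refine ⟨insert c S, Finset.insert_subset hc.1 hSA, by rw [Finset.card_insert_of_notMem hc.2, hS],
      ?_⟩
    intro a ha b hb hbS
    rw [Finset.mem_insert, not_or] at hbS
    rcases Finset.mem_insert.1 ha with rfl | ha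
    · exact hmin b (Finset.mem_sdiff.2 ⟨hb, hbS.2⟩)
    · exact h a ha b hb hbS.2

/-- A greedily chosen set of `j` elements leaves few sets without a common element. -/
theorem Finset.exists_greedy_hitting {V ι : Type*} [DecidableEq V] [Fintype ι] (A : Finset V)
    (N : ι → Finset V) (K : ℕ) (hA : A.Nonempty) (hN : ∀ i, N i ⊆ A) (hK : ∀ i, K ≤ (N i).card)
    (j : ℕ) :
    ∃ X ⊆ A, X.card ≤ j ∧ ((Finset.univ.filter fun i => Disjoint X (N i)).card : ℝ) ≤
      Fintype.card ι * (1 - (K : ℝ) / A.card) ^ j := by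
  have hApos : (0 : ℝ) < A.card := by exact_mod_cast hA.card_pos
  induction j with
  | zero => exact ⟨∅, by simp, by simp, by simp⟩
  | succ j ih =>
    obtain ⟨X, hXA, hX, h⟩ := ih
    set U := Finset.univ.filter fun i => Disjoint X (N i) with hU
    -- In this case the factor `1 - K / A.card` is negative, but there are no sets to be hit.
    by_cases hKA : A.card < K
    · have : IsEmpty ι := ⟨fun i => by
        have := Finset.card_le_card (hN i)
        have := hK i
        omega⟩
      exact ⟨∅, by simp, by simp, by simp⟩
    -- Double counting of the incidences between `A` and the sets not yet hit: on average an element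
    -- of `A` lies in a fraction `K / A.card` of them.
    have hsum : K * U.card ≤ ∑ a ∈ A, (U.filter fun i => a ∈ N i).card := by
      have : ∑ a ∈ A, (U.filter fun i => a ∈ N i).card = ∑ i ∈ U, (N i).card := by
        simp_rw [Finset.card_filter]
        rw [Finset.sum_comm]
        refine Finset.sum_congr rfl fun i _ => ?_
        rw [← Finset.card_filter, Finset.filter_mem_eq_inter, Finset.inter_eq_right.2 (hN i)]
      rw [this, mul_comm, ← smul_eq_mul]
      exact Finset.card_nsmul_le_sum _ _ _ fun i _ => hK i
    obtain ⟨a, ha, hle⟩ : ∃ a ∈ A, K * (U.card : ℝ) / A.card ≤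
        ((U.filter fun i => a ∈ N i).card : ℝ) := by
      by_contra! hcon
      have h1 := Finset.sum_lt_sum_of_nonempty hA hcon
      rw [Finset.sum_const, nsmul_eq_mul, mul_div_cancel₀ _ hApos.ne'] at h1
      have h2 : (K * (U.card : ℝ)) ≤ ∑ a ∈ A, ((U.filter fun i => a ∈ N i).card : ℝ) := by
        exact_mod_cast hsum
      linarith
    refine ⟨insert a X, Finset.insert_subset ha hXA, (Finset.card_insert_le _ _).trans (by omega),
      ?_⟩
    have hcard : (Finset.univ.filter fun i => Disjoint (insert a X) (N i)).card +
        (U.filter fun i => a ∈ N i).card = U.card := by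
      rw [add_comm, ← Finset.card_filter_add_card_filter_not (s := U) (fun i => a ∈ N i)]
      congr 2
      ext i
      simp [hU, Finset.disjoint_insert_left, and_comm]
    have hcard' : ((Finset.univ.filter fun i => Disjoint (insert a X) (N i)).card : ℝ) +
        ((U.filter fun i => a ∈ N i).card : ℝ) = U.card := by exact_mod_cast hcard
    have hfac : 0 ≤ 1 - (K : ℝ) / A.card := by
      rw [sub_nonneg, div_le_one hApos]
      exact_mod_cast not_lt.1 hKA
    calc ((Finset.univ.filter fun i => Disjoint (insert a X) (N i)).card : ℝ)
        ≤ U.card - K * (U.card : ℝ) / A.card := by linarith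
      _ = U.card * (1 - (K : ℝ) / A.card) := by ring
      _ ≤ _ := by
        rw [pow_succ, ← mul_assoc]
        exact mul_le_mul_of_nonneg_right h hfac

/-- After `j > A.card * L / K` greedy choices the number of sets left is below `2 ^ L * exp (-L) ≤
1`, hence zero. -/
theorem Finset.exists_hitting {V ι : Type*} [DecidableEq V] [Fintype ι] (A : Finset V)
    (N : ι → Finset V) {K L : ℕ} (hK0 : 0 < K) (hN : ∀ i, N i ⊆ A) (hK : ∀ i, K ≤ (N i).card)
    (hL : Fintype.card ι ≤ 2 ^ L) :
    ∃ X ⊆ A, X.card ≤ A.card * L / K + 1 ∧ ∀ i, ∃ x ∈ X, x ∈ N i := by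
  rcases isEmpty_or_nonempty ι with hι | ⟨⟨i₀⟩⟩
  · exact ⟨∅, by simp, by simp, fun i => (hι.false i).elim⟩
  have hA : A.Nonempty :=
    (Finset.card_pos.1 (hK0.trans_le (hK i₀))).mono (hN i₀)
  have hApos : (0 : ℝ) < A.card := by exact_mod_cast hA.card_pos
  obtain ⟨X, hXA, hX, h⟩ := Finset.exists_greedy_hitting A N K hA hN hK (A.card * L / K + 1)
  refine ⟨X, hXA, hX, ?_⟩
  set j := A.card * L / K + 1
  have hKA : (K : ℝ) ≤ A.card := by
    exact_mod_cast (hK i₀).trans (Finset.card_le_card (hN i₀))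
  have hj : (L : ℝ) < j * (K / A.card) := by
    have : A.card * L < j * K := by
      rw [mul_comm j]; exact Nat.lt_mul_div_succ _ hK0
    rw [← mul_div_assoc, lt_div_iff₀ hApos, mul_comm]
    exact_mod_cast this
  have hlt : ((Finset.univ.filter fun i => Disjoint X (N i)).card : ℝ) < 1 := by
    refine h.trans_lt ?_
    have h1 : (1 - (K : ℝ) / A.card) ^ j ≤ Real.exp (-(j * (K / A.card))) := by
      rw [← mul_neg, Real.exp_nat_mul]
      refine pow_le_pow_left₀ ?_ (by linarith [Real.add_one_le_exp (-((K : ℝ) / A.card))]) _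
      rw [sub_nonneg, div_le_one hApos]
      exact hKA
    have h2 : Real.exp (-(j * (K / A.card))) < Real.exp (-(L : ℝ)) := Real.exp_lt_exp.2 (by linarith)
    have h3 : (Fintype.card ι : ℝ) ≤ Real.exp L := by
      calc (Fintype.card ι : ℝ) ≤ 2 ^ L := by exact_mod_cast hL
        _ ≤ Real.exp 1 ^ L := pow_le_pow_left₀ (by norm_num)
          (by linarith [Real.add_one_le_exp (1 : ℝ)]) _
        _ = Real.exp L := by rw [← Real.exp_nat_mul, mul_one]
    have hι : (0 : ℝ) < Fintype.card ι := by
      exact_mod_cast Fintype.card_pos_iff.2 ⟨i₀⟩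
    calc (Fintype.card ι : ℝ) * (1 - (K : ℝ) / A.card) ^ j
        < Fintype.card ι * Real.exp (-(L : ℝ)) := mul_lt_mul_of_pos_left (h1.trans_lt h2) hι
      _ ≤ Real.exp L * Real.exp (-(L : ℝ)) := mul_le_mul_of_nonneg_right h3 (Real.exp_pos _).le
      _ = 1 := by rw [← Real.exp_add, add_neg_cancel, Real.exp_zero]
  have h0 : (Finset.univ.filter fun i => Disjoint X (N i)).card = 0 := by
    have : (Finset.univ.filter fun i => Disjoint X (N i)).card < 1 := by exact_mod_cast hlt
    omega
  intro i
  by_contra hcon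
  rw [Finset.card_eq_zero, Finset.filter_eq_empty_iff] at h0
  refine h0 (Finset.mem_univ i) (Finset.disjoint_left.2 fun x hx hx' => hcon ⟨x, hx, hx'⟩)

/-! ### Hubs -/

/-- Every point `v` of a finite semimetric space has `j + 1` hubs and a small bunch, such that for
any two points some hub of one of them is in the bunch of the other and is almost between them. -/
theorem exists_hubs_aux {V : Type*} [DecidableEq V] (δ : V → V → ℕ)
    (hsymm : ∀ u v, δ u v = δ v u) (htri : ∀ u v w, δ u w ≤ δ u v + δ v w) (B : Finset V)
    {H L : ℕ} (hH : 1 ≤ H) (hL : 1 ≤ L) (hB : B.card ≤ 2 ^ L) (hne : B.Nonempty) (j : ℕ) :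
    ∀ (C : ℕ) (A : Finset V) (p : V → V), 1 ≤ C → A ⊆ B → (∀ v ∈ B, p v ∈ A) →
      A.card ≤ H ^ (j + 1) * C →
      ∃ (piv : ℕ → V → V) (bunch : V → Finset V),
        (∀ v ∈ B, (bunch v).card ≤ j * H + H * C * (3 * L) ^ j) ∧ (∀ v ∈ B, bunch v ⊆ B) ∧
        (∀ i ≤ j, ∀ v ∈ B, piv i v ∈ B) ∧
        ∀ e, ∀ u ∈ B, ∀ v ∈ B, δ u (p u) ≤ e * δ u v → δ v (p v) ≤ e * δ u v →
          ∃ i ≤ j,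
            (piv i u ∈ bunch v ∧ δ u (piv i u) + δ (piv i u) v ≤ (2 * (e + j) + 1) * δ u v) ∨
            (piv i v ∈ bunch u ∧ δ v (piv i v) + δ (piv i v) u ≤ (2 * (e + j) + 1) * δ u v) := by
  -- The detour through `w` costs at most `2 * δ u w` more than `δ u v`.
  have hmid : ∀ e u w v, δ u w ≤ e * δ u v → ∀ j,
      δ u w + δ w v ≤ (2 * (e + j) + 1) * δ u v := by
    intro e u w v h j
    have h1 := htri w u v
    rw [hsymm w u] at h1
    have : (2 * (e + j) + 1) * δ u v = 2 * (e * δ u v) + 2 * (j * δ u v) + δ u v := by ring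
    rw [this]
    have := Nat.zero_le (j * δ u v)
    omega
  induction j with
  | zero =>
    intro C A p _ hAB hp hA
    -- On the last level the bunch is all of `A`, so the hub of `u` is certainly found.
    refine ⟨fun _ => p, fun _ => A, fun v _ => by simpa using hA, fun v _ => hAB,
      fun i _ v hv => hAB (hp v hv), fun e u hu v hv h1 h2 => ⟨0, le_rfl, Or.inl ⟨hp u hu, ?_⟩⟩⟩
    exact hmid e u (p u) v h1 0
  | succ j ih =>
    intro C A p hC hAB hp hA
    obtain ⟨v₀, hv₀⟩ := hne
    have hApos : 0 < A.card := Finset.card_pos.2 ⟨_, hp v₀ hv₀⟩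
    have hK0 : 0 < min H A.card := lt_min hH hApos
    -- This level contributes to the bunch of `v` the `H` elements of `A` nearest to `v` (all of `A`
    -- if it is smaller). A set `X` hitting these replaces `A` on the next level.
    choose N hNA hN hnear using fun v : V =>
      Finset.exists_nearest A (δ v) (min_le_right H A.card)
    obtain ⟨X, hXA, hX, hhit⟩ := Finset.exists_hitting (ι := B) A (fun v => N v) hK0
      (fun v => hNA v) (fun v => (hN v).ge) (by simpa using hB)
    choose q hqX hqN using hhit
    -- The bound drops by a factor `H`, up to the logarithmic factor `3 * L`, which is collected in
    -- `C`.
    have hXcard : X.card ≤ H ^ (j + 1) * (C * (3 * L)) := by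
      have h1 : A.card * L / min H A.card ≤ H ^ (j + 1) * C * L + L := by
        rcases le_total H A.card with h | h
        · rw [min_eq_left h]
          refine le_trans (Nat.div_le_of_le_mul ?_) (Nat.le_add_right _ _)
          calc A.card * L ≤ H ^ (j + 1 + 1) * C * L := Nat.mul_le_mul_right _ hA
            _ = H * (H ^ (j + 1) * C * L) := by ring
        · rw [min_eq_right h, Nat.mul_div_cancel_left _ hApos]
          exact Nat.le_add_left _ _
      have h2 : 1 ≤ H ^ (j + 1) * C := Nat.mul_pos (Nat.pow_pos hH) hC
      have h3 : L ≤ H ^ (j + 1) * C * L := Nat.le_mul_of_pos_left _ h2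
      have h4 : H ^ (j + 1) * (C * (3 * L)) = 3 * (H ^ (j + 1) * C * L) := by ring
      rw [h4]
      omega
    let p' : V → V := fun v => if h : v ∈ B then q ⟨v, h⟩ else v
    have hp' : ∀ v ∈ B, p' v ∈ X ∧ p' v ∈ N v := fun v hv => by
      simp only [p', dif_pos hv]
      exact ⟨hqX ⟨v, hv⟩, hqN ⟨v, hv⟩⟩
    obtain ⟨piv, bunch, h1, h2, h3, h4⟩ := ih (C * (3 * L)) X p'
      (Nat.mul_pos hC (by omega)) (hXA.trans hAB) (fun v hv => (hp' v hv).1) hXcard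
    refine ⟨fun i => if i = 0 then p else piv (i - 1), fun v => N v ∪ bunch v, fun v hv => ?_,
      fun v hv => Finset.union_subset ((hNA v).trans hAB) (h2 v hv), fun i hi v hv => ?_,
      fun e u hu v hv hpu hpv => ?_⟩
    · refine (Finset.card_union_le _ _).trans ?_
      have := h1 v hv
      have h5 : (N v).card ≤ H := (hN v).le.trans (min_le_left _ _)
      have h6 : (j + 1) * H + H * C * (3 * L) ^ (j + 1) =
        H + (j * H + H * (C * (3 * L)) * (3 * L) ^ j) := by ring
      omega
    · by_cases h : i = 0
      · simp only [h, if_true]; exact hAB (hp v hv)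
      · simp only [h, if_false]; exact h3 _ (by omega) v hv
    · by_cases hu' : p u ∈ N v
      · exact ⟨0, by omega, Or.inl ⟨Finset.mem_union_left _ hu', hmid e u (p u) v hpu _⟩⟩
      by_cases hv' : p v ∈ N u
      · refine ⟨0, by omega, Or.inr ⟨Finset.mem_union_left _ hv', ?_⟩⟩
        rw [hsymm u v] at hpv ⊢
        exact hmid e v (p v) u hpv _
      -- As `p u` is not among the elements nearest to `v`, the new pivot of `v` is no farther from
      -- `v` than `p u`, hence within `(e + 1) * δ u v`. The same holds with `u` and `v` exchanged,
      -- so both endpoints advance a level together.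
      have a1 := hnear v _ (hp' v hv).2 _ (hp u hu) hu'
      have a2 := hnear u _ (hp' u hu).2 _ (hp v hv) hv'
      have b1 := htri v u (p u)
      have b2 := htri u v (p v)
      rw [hsymm v u] at b1
      obtain ⟨i, hi, h⟩ := h4 (e + 1) u hu v hv (by rw [Nat.succ_mul]; omega)
        (by rw [Nat.succ_mul]; omega)
      refine ⟨i + 1, by omega, ?_⟩
      simp only [Nat.add_sub_cancel, Nat.succ_ne_zero, if_false]
      rw [show e + (j + 1) = e + 1 + j by ring]
      exact h.imp (fun h => ⟨Finset.mem_union_right _ h.1, h.2⟩)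
        (fun h => ⟨Finset.mem_union_right _ h.1, h.2⟩)

/-- This is the case `e = 0` with `k` levels, where each point is its own first pivot. Adding `δ u
v` on the left expresses the stretch `2k - 1` without subtraction. -/
theorem exists_hubs {V : Type*} [DecidableEq V] (δ : V → V → ℕ) (hself : ∀ v, δ v v = 0)
    (hsymm : ∀ u v, δ u v = δ v u) (htri : ∀ u v w, δ u w ≤ δ u v + δ v w) (B : Finset V)
    {k H L : ℕ} (hk : 0 < k) (hH : 1 ≤ H) (hL : 1 ≤ L) (hB : B.card ≤ 2 ^ L) (hne : B.Nonempty)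
    (hBH : B.card ≤ H ^ k) :
    ∃ (piv : ℕ → V → V) (bunch : V → Finset V),
      (∀ v ∈ B, (bunch v).card ≤ 2 * k * H * (3 * L) ^ k) ∧ (∀ v ∈ B, bunch v ⊆ B) ∧
      (∀ i < k, ∀ v ∈ B, piv i v ∈ B) ∧
      ∀ u ∈ B, ∀ v ∈ B, ∃ i < k,
        (piv i u ∈ bunch v ∧ δ u (piv i u) + δ (piv i u) v + δ u v ≤ 2 * k * δ u v) ∨
        (piv i v ∈ bunch u ∧ δ v (piv i v) + δ (piv i v) u + δ u v ≤ 2 * k * δ u v) := by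
  obtain ⟨j, rfl⟩ : ∃ j, k = j + 1 := ⟨k - 1, by omega⟩
  obtain ⟨piv, bunch, h1, h2, h3, h4⟩ := exists_hubs_aux δ hsymm htri B hH hL hB hne j 1 B id le_rfl
    subset_rfl (fun v hv => hv) (by simpa using hBH)
  refine ⟨piv, bunch, fun v hv => (h1 v hv).trans ?_, h2, fun i hi => h3 i (by omega),
    fun u hu v hv => ?_⟩
  · have e1 : 1 ≤ (3 * L) ^ j := Nat.pow_pos (by omega)
    have e2 : (3 * L) ^ j ≤ (3 * L) ^ (j + 1) := Nat.pow_le_pow_right (by omega) (by omega)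
    calc j * H + H * 1 * (3 * L) ^ j ≤ j * H * (3 * L) ^ j + H * 1 * (3 * L) ^ j :=
          Nat.add_le_add_right (Nat.le_mul_of_pos_right _ e1) _
      _ = (j + 1) * H * (3 * L) ^ j := by ring
      _ ≤ 2 * (j + 1) * H * (3 * L) ^ (j + 1) :=
          Nat.mul_le_mul (Nat.mul_le_mul_right _ (by omega)) e2
  · obtain ⟨i, hi, h⟩ := h4 0 u hu v hv (by simp [hself]) (by simp [hself])
    refine ⟨i, by omega, ?_⟩
    have e : 2 * (j + 1) * δ u v = (2 * (0 + j) + 1) * δ u v + δ u v := by ring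
    rw [e]
    exact h.imp (fun h => ⟨h.1, by omega⟩) (fun h => ⟨h.1, by omega⟩)

/-! ### The search through near sets -/

section Search

variable {V : Type*} (δ : V → V → ℕ) (N : V → Finset V)

/-- The pairs that are reached from `(s, t)` by `m` moves of one of the two vertices to a vertex of
its near set, with the total length of the moves. -/
inductive Reach (s t : V) : ℕ → V → V → ℕ → Prop
  | start : Reach s t 0 s t 0
  | left {m : ℕ} {x y : V} {a : ℕ} (x' : V) :
      Reach s t m x y a → x' ∈ N x → Reach s t (m + 1) x' y (a + δ x x')
  | right {m : ℕ} {x y : V} {a : ℕ} (y' : V) :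
      Reach s t m x y a → y' ∈ N y → Reach s t (m + 1) x y' (a + δ y y')

variable {δ N}

theorem Reach.le (hsymm : ∀ u v, δ u v = δ v u)
    (htri : ∀ u v w, δ u w ≤ δ u v + δ v w) {s t x y : V} {m a : ℕ}
    (h : Reach δ N s t m x y a) : δ s t ≤ a + δ x y := by
  induction h with
  | start => omega
  | @left m x y a x' _ _ ih => have := htri x x' y; omega
  | @right m x y a y' _ _ ih =>
    have := htri x y' y
    rw [hsymm y' y] at this
    omega

/-- Staying in place is a move too, so searches of exactly `M` moves include all shorter ones. -/
theorem Reach.pad (hself : ∀ v, δ v v = 0) (hmem : ∀ v, v ∈ N v) {s t x y : V} {m a : ℕ}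
    (h : Reach δ N s t m x y a) {m' : ℕ} (hm : m ≤ m') : Reach δ N s t m' x y a := by
  induction hm with
  | refl => exact h
  | step _ ih => simpa [hself] using ih.left x (hmem x)

variable {p : V → V} {Q INF g E d : ℕ}

/-- Let a shortest path from `x` to `y` leave `N x` along `uu'`. If `u' ∉ N u`, the pivot of `u` is
no farther than `u'`, and `hsmall` makes it close. If `u' ∈ N u`, then `δ x u' ≥ δ x (p x)` because
`u' ∉ N x`; so `g` times the remaining distance falls by more than `d`, and `f` decreases. -/
theorem exists_move (hnear : ∀ v, ∀ a ∈ N v, ∀ b, b ∉ N v → δ v a ≤ δ v b)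
    (hmem : ∀ v, v ∈ N v) (hp : ∀ v, p v ∈ N v)
    (htri : ∀ u v w, δ u w ≤ δ u v + δ v w)
    (hcross : ∀ x y, δ x y < INF → ∀ S : Finset V, x ∈ S → y ∉ S → ∃ u ∈ S, ∃ u' ∉ S,
      ∃ ω ≤ Q, δ u u' ≤ ω ∧ δ x u + ω + δ u' y ≤ δ x y)
    (hsmall : ∀ r ≤ Q, r ≤ d → g * r ≤ d + E) (hd : d < INF) {x y : V} {f : ℕ}
    (hxy : δ x y ≤ d) (hf : g * δ x y ≤ f * d) (hx : d + E < g * δ x (p x)) :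
    y ∈ N x ∨
      (∃ u ∈ N x, g * δ u (p u) ≤ d + E ∧ δ x u + δ u y ≤ δ x y) ∨
      (∃ u ∈ N x, ∃ u' ∈ N u, ∃ f', f = f' + 1 ∧ δ x u + δ u u' + δ u' y ≤ δ x y ∧
        g * δ u' y ≤ f' * d) := by
  by_cases hy : y ∈ N x
  · exact Or.inl hy
  obtain ⟨u, hu, u', hu', ω, hω, hle, hsum⟩ := hcross x y (by omega) (N x) (hmem x) hy
  by_cases huu : u' ∈ N u
  · refine Or.inr (Or.inr ⟨u, hu, u', huu, f - 1, ?_⟩)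
    have h1 := hnear x _ (hp x) _ hu'
    have h2 := htri x u u'
    have h3 : g * δ x (p x) + g * δ u' y ≤ g * δ x y := by
      rw [← mul_add]; exact Nat.mul_le_mul_left _ (by omega)
    obtain ⟨f', rfl⟩ : ∃ f', f = f' + 1 := by
      cases f with
      | zero => rw [zero_mul] at hf; omega
      | succ f' => exact ⟨f', rfl⟩
    rw [Nat.succ_mul] at hf
    refine ⟨rfl, by omega, ?_⟩
    simp only [Nat.add_sub_cancel]
    omega
  · refine Or.inr (Or.inl ⟨u, hu, ?_, ?_⟩)
    · have h1 := hnear u _ (hp u) _ huu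
      exact hsmall _ (by omega) (by omega)
    · have := htri u u' y
      omega

-- The potential is `2 * f` plus the number of current vertices whose pivot is far. A single move to
-- a vertex with a close pivot lowers it by one. A double move lowers `f` by one, and the vertex
-- that moved was counted as far already, so the potential falls by at least two.
open Classical in
theorem Reach.exists_good (hnear : ∀ v, ∀ a ∈ N v, ∀ b, b ∉ N v → δ v a ≤ δ v b)
    (hmem : ∀ v, v ∈ N v) (hp : ∀ v, p v ∈ N v) (hself : ∀ v, δ v v = 0)
    (hsymm : ∀ u v, δ u v = δ v u) (htri : ∀ u v w, δ u w ≤ δ u v + δ v w)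
    (hcross : ∀ x y, δ x y < INF → ∀ S : Finset V, x ∈ S → y ∉ S → ∃ u ∈ S, ∃ u' ∉ S,
      ∃ ω ≤ Q, δ u u' ≤ ω ∧ δ x u + ω + δ u' y ≤ δ x y)
    (hsmall : ∀ r ≤ Q, r ≤ d → g * r ≤ d + E) (hd : d < INF) {s t : V} (j : ℕ) :
    ∀ (f m : ℕ) (x y : V) (a : ℕ), Reach δ N s t m x y a → a + δ x y ≤ d →
      g * δ x y ≤ f * d →
      2 * f + (if g * δ x (p x) ≤ d + E then 0 else 1) +
        (if g * δ y (p y) ≤ d + E then 0 else 1) ≤ j →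
      ∃ x' y' a', Reach δ N s t (m + j) x' y' a' ∧ a' + δ x' y' ≤ d ∧
        (x' = y' ∨ (g * δ x' (p x') ≤ d + E ∧ g * δ y' (p y') ≤ d + E)) := by
  induction j using Nat.strong_induction_on with
  | _ j ih =>
    have hone : ∀ v, (if g * δ v (p v) ≤ d + E then 0 else 1) ≤ 1 := fun v => by
      split_ifs <;> omega
    intro f m x y a hR ha hf hj
    by_cases hx : g * δ x (p x) ≤ d + E
    · by_cases hy : g * δ y (p y) ≤ d + E
      · exact ⟨x, y, a, hR.pad hself hmem (by omega), ha, Or.inr ⟨hx, hy⟩⟩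
      · rw [if_pos hx, if_neg hy] at hj
        rw [hsymm] at ha hf
        rcases exists_move hnear hmem hp htri hcross hsmall hd (by omega) hf (not_le.1 hy) with
          h | ⟨u, hu, h1, h2⟩ | ⟨u, hu, u', hu', f', rfl, h1, h2⟩
        · refine ⟨x, x, _, (hR.right x h).pad hself hmem (by omega), ?_, Or.inl rfl⟩
          rw [hself]; omega
        · obtain ⟨x', y', a', b1, b2, b3⟩ := ih (j - 1) (by omega) f (m + 1) x u _
            (hR.right u hu) (by rw [hsymm x u]; omega)
            (by rw [hsymm x u]; exact (Nat.mul_le_mul_left _ (by omega)).trans hf)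
            (by rw [if_pos hx, if_pos h1]; omega)
          exact ⟨x', y', a', b1.pad hself hmem (by omega), b2, b3⟩
        · have := hone u'
          obtain ⟨x', y', a', b1, b2, b3⟩ := ih (j - 2) (by omega) f' (m + 1 + 1) x u' _
            ((hR.right u hu).right u' hu') (by rw [hsymm x u']; omega)
            (by rw [hsymm x u']; exact h2) (by rw [if_pos hx]; omega)
          exact ⟨x', y', a', b1.pad hself hmem (by omega), b2, b3⟩
    · rw [if_neg hx] at hj
      have hy1 := hone y
      rcases exists_move hnear hmem hp htri hcross hsmall hd (by omega) hf (not_le.1 hx) with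
        h | ⟨u, hu, h1, h2⟩ | ⟨u, hu, u', hu', f', rfl, h1, h2⟩
      · refine ⟨y, y, _, (hR.left y h).pad hself hmem (by omega), ?_, Or.inl rfl⟩
        rw [hself]; omega
      · obtain ⟨x', y', a', b1, b2, b3⟩ := ih (j - 1) (by omega) f (m + 1) u y _
          (hR.left u hu) (by omega) ((Nat.mul_le_mul_left _ (by omega)).trans hf)
          (by rw [if_pos h1]; omega)
        exact ⟨x', y', a', b1.pad hself hmem (by omega), b2, b3⟩
      · have := hone u'
        obtain ⟨x', y', a', b1, b2, b3⟩ := ih (j - 2) (by omega) f' (m + 1 + 1) u' y _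
          ((hR.left u hu).left u' hu') (by omega) h2 (by omega)
        exact ⟨x', y', a', b1.pad hself hmem (by omega), b2, b3⟩

end Search

/-! ### Capped distances -/

namespace SimpleGraph

variable {V : Type*} {G : SimpleGraph V} (w : Sym2 V → ℕ) (c : ℕ)

def Walk.weight {s t : V} (p : G.Walk s t) : ℕ := (p.edges.map w).sum

variable (G) in
/-- The least weight of a walk, or `c` if this is smaller. -/
noncomputable def cappedDist (s t : V) : ℕ :=
  sInf (insert c (Set.range fun p : G.Walk s t => p.weight w))

theorem cappedDist_le (s t : V) : G.cappedDist w c s t ≤ c :=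
  Nat.sInf_le (Set.mem_insert _ _)

theorem cappedDist_le_weight {s t : V} (p : G.Walk s t) : G.cappedDist w c s t ≤ p.weight w :=
  Nat.sInf_le (Set.mem_insert_of_mem _ ⟨p, rfl⟩)

theorem exists_weight_eq_cappedDist {s t : V} (h : G.cappedDist w c s t < c) :
    ∃ p : G.Walk s t, p.weight w = G.cappedDist w c s t := by
  rcases Nat.sInf_mem (Set.insert_nonempty c (Set.range fun p : G.Walk s t => p.weight w)) with
    h' | h'
  · exact absurd h' h.ne
  · exact h'

theorem Walk.weight_append {s t u : V} (p : G.Walk s t) (q : G.Walk t u) :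
    (p.append q).weight w = p.weight w + q.weight w := by
  simp [weight, Walk.edges_append]

theorem cappedDist_self (v : V) : G.cappedDist w c v v = 0 :=
  Nat.eq_zero_of_le_zero (cappedDist_le_weight w c (Walk.nil : G.Walk v v))

theorem cappedDist_comm (s t : V) : G.cappedDist w c s t = G.cappedDist w c t s := by
  unfold cappedDist
  congr 2
  ext x
  constructor <;> rintro ⟨p, rfl⟩ <;> exact ⟨p.reverse, by simp [Walk.weight]⟩

theorem cappedDist_triangle (s t u : V) :
    G.cappedDist w c s u ≤ G.cappedDist w c s t + G.cappedDist w c t u := by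
  by_cases h1 : G.cappedDist w c s t < c
  · by_cases h2 : G.cappedDist w c t u < c
    · obtain ⟨p, hp⟩ := exists_weight_eq_cappedDist w c h1
      obtain ⟨q, hq⟩ := exists_weight_eq_cappedDist w c h2
      rw [← hp, ← hq, ← Walk.weight_append]
      exact cappedDist_le_weight w c _
    · have := cappedDist_le (G := G) w c s u
      omega
  · have := cappedDist_le (G := G) w c s u
    omega

theorem Walk.exists_crossing (S : Finset V) {x y : V} (p : G.Walk x y) (hx : x ∈ S)
    (hy : y ∉ S) : ∃ u ∈ S, ∃ u' ∉ S, G.Adj u u' ∧ ∃ (p₁ : G.Walk x u) (p₂ : G.Walk u' y),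
      p₁.weight w + w s(u, u') + p₂.weight w = p.weight w := by
  induction p with
  | nil => exact absurd hx hy
  | @cons x z y hadj p ih =>
    by_cases hz : z ∈ S
    · obtain ⟨u, hu, u', hu', huu, p₁, p₂, h⟩ := ih hz hy
      refine ⟨u, hu, u', hu', huu, Walk.cons hadj p₁, p₂, ?_⟩
      simp only [Walk.weight, Walk.edges_cons, List.map_cons, List.sum_cons] at h ⊢
      omega
    · exact ⟨x, hx, z, hz, hadj, Walk.nil, p, by simp [Walk.weight]⟩

/-- Below the cap the distance is attained by a walk, and this walk has to leave `S` along some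
edge. It is the only property of graphs, beyond the semimetric, that the search uses. -/
theorem cappedDist_crossing {Q : ℕ} (hw : ∀ e ∈ G.edgeSet, w e ≤ Q) {x y : V}
    (h : G.cappedDist w c x y < c) (S : Finset V) (hx : x ∈ S) (hy : y ∉ S) :
    ∃ u ∈ S, ∃ u' ∉ S, ∃ ω ≤ Q, G.cappedDist w c u u' ≤ ω ∧
      G.cappedDist w c x u + ω + G.cappedDist w c u' y ≤ G.cappedDist w c x y := by
  obtain ⟨p, hp⟩ := exists_weight_eq_cappedDist w c h
  obtain ⟨u, hu, u', hu', huu, p₁, p₂, hsum⟩ := p.exists_crossing w S hx hy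
  refine ⟨u, hu, u', hu', w s(u, u'), hw _ huu, ?_, ?_⟩
  · simpa [Walk.weight] using cappedDist_le_weight w c (Walk.cons huu Walk.nil)
  · have h1 := cappedDist_le_weight w c p₁
    have h2 := cappedDist_le_weight w c p₂
    omega

end SimpleGraph

/-! ### The tables of a graph -/

theorem Finset.exists_enumeration {V : Type*} (S : Finset V) {K : ℕ} (hK : 0 < K)
    (hS : S.card = K) : ∃ f : ℕ → V, (∀ i, f i ∈ S) ∧ ∀ a ∈ S, ∃ i < K, f i = a := by
  have e := S.equivFinOfCardEq hS
  refine ⟨fun i => e.symm ⟨i % K, Nat.mod_lt _ hK⟩, fun i => (e.symm _).2, fun a ha => ?_⟩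
  refine ⟨e ⟨a, ha⟩, (e ⟨a, ha⟩).2, ?_⟩
  simp [Nat.mod_eq_of_lt (e ⟨a, ha⟩).2]

/-- For the sorted keys of the dictionary. The last clause covers the padding of the table, which
has to consist of words as well. -/
theorem Finset.exists_increasing (S : Finset ℕ) :
    ∃ f : ℕ → ℕ, (∀ i j, i < j → j < S.card → f i < f j) ∧
      (∀ q, q ∈ S ↔ ∃ i < S.card, f i = q) ∧ ∀ i, f i ∈ S ∨ f i = 0 := by
  refine ⟨fun i => if h : i < S.card then S.orderEmbOfFin rfl ⟨i, h⟩ else 0, ?_, ?_, ?_⟩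
  · intro i j hij hj
    simp only [dif_pos hj, dif_pos (hij.trans hj)]
    exact (S.orderEmbOfFin rfl).strictMono (by simpa using hij)
  · intro q
    constructor
    · intro hq
      have : q ∈ Set.range (S.orderEmbOfFin rfl) := by rw [Finset.range_orderEmbOfFin]; exact hq
      obtain ⟨i, hi⟩ := this
      exact ⟨i, i.2, by simp only [dif_pos i.2]; exact hi⟩
    · rintro ⟨i, hi, rfl⟩
      simp only [dif_pos hi]
      exact Finset.orderEmbOfFin_mem _ _ _
  · intro i
    by_cases h : i < S.card
    · simp only [dif_pos h]
      exact Or.inl (Finset.orderEmbOfFin_mem _ _ _)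
    · exact Or.inr (dif_neg h)

/-! ### Codes and the searches they describe -/

namespace WordRAM

/-- The lists of near vertices in the tables `D` are those of the near sets `N`. -/
structure Tables.Lists {n : ℕ} (D : Tables) (δ : Fin n → Fin n → ℕ) (N : Fin n → Finset (Fin n)) :
    Prop where
  K_pos : 0 < D.K
  mem : ∀ (x : Fin n), ∀ i < D.K, ∃ a ∈ N x, D.ballVertex (x * D.K + i) = a ∧
    D.ballDist (x * D.K + i) = δ x a
  exists_index : ∀ x, ∀ a ∈ N x, ∃ i < D.K, D.ballVertex (x * D.K + i) = a ∧
    D.ballDist (x * D.K + i) = δ x a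

variable {n : ℕ} {D : Tables} {δ : Fin n → Fin n → ℕ} {N : Fin n → Finset (Fin n)}

/-- Soundness: every number encodes some legal search. With `Reach.le` this prevents underestimates.
-/
theorem Tables.Lists.reach (h : D.Lists δ N) (s t : Fin n) (e m : ℕ) :
    ∃ (x y : Fin n) (a e' : ℕ), D.move^[m] (s, t, 0, e) = (↑x, ↑y, a, e') ∧
      Reach δ N s t m x y a := by
  have hK := h.K_pos
  induction m with
  | zero => exact ⟨s, t, 0, e, rfl, Reach.start⟩
  | succ m ih =>
    obtain ⟨x, y, a, e', he, hR⟩ := ih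
    rw [Function.iterate_succ_apply', he]
    have hlt : e' % (2 * D.K) < 2 * D.K := Nat.mod_lt _ (by omega)
    unfold Tables.move
    split_ifs with hc
    · obtain ⟨x', hx', h1, h2⟩ := h.mem x _ hc
      exact ⟨x', y, a + δ x x', e' / (2 * D.K), by simp only at *; rw [h1, h2], hR.left x' hx'⟩
    · obtain ⟨y', hy', h1, h2⟩ := h.mem y (e' % (2 * D.K) - D.K) (by simp only at hc; omega)
      exact ⟨x, y', a + δ y y', e' / (2 * D.K), by simp only at *; rw [h1, h2], hR.right y' hy'⟩

/-- Completeness of the codes. The higher digits `q` are left arbitrary so that the induction can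
append the next move as the digit of weight `(2 * D.K) ^ m`. -/
theorem Tables.Lists.exists_code (h : D.Lists δ N) {s t x y : Fin n} {m a : ℕ}
    (hR : Reach δ N s t m x y a) : ∃ e < (2 * D.K) ^ m, ∀ q,
      D.move^[m] (s, t, 0, e + (2 * D.K) ^ m * q) = (↑x, ↑y, a, q) := by
  have hK := h.K_pos
  have hcode : ∀ m e g, e < (2 * D.K) ^ m → g < 2 * D.K →
      e + (2 * D.K) ^ m * g < (2 * D.K) ^ (m + 1) := by
    intro m e g he hg
    have := Nat.mul_le_mul_left ((2 * D.K) ^ m) (Nat.succ_le_of_lt hg)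
    rw [Nat.mul_succ] at this
    rw [pow_succ]
    omega
  have hsplit : ∀ m e g q : ℕ, e + (2 * D.K) ^ m * g + (2 * D.K) ^ (m + 1) * q =
      e + (2 * D.K) ^ m * (g + 2 * D.K * q) := by
    intro m e g q
    ring
  induction hR with
  | start => exact ⟨0, by simp, fun q => by simp⟩
  | @left m x y a x' _ hx' ih =>
    obtain ⟨e, he, hq⟩ := ih
    obtain ⟨i, hi, h1, h2⟩ := h.exists_index x x' hx'
    refine ⟨_, hcode m e i he (by omega), fun q => ?_⟩
    have h3 : (i + 2 * D.K * q) % (2 * D.K) = i := by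
      rw [Nat.add_mul_mod_self_left, Nat.mod_eq_of_lt (by omega)]
    have h4 : (i + 2 * D.K * q) / (2 * D.K) = q := by
      rw [Nat.add_mul_div_left _ _ (by omega), Nat.div_eq_of_lt (by omega), zero_add]
    rw [hsplit, Function.iterate_succ_apply', hq, Tables.move]
    simp only [h3, h4, if_pos hi, h1, h2]
  | @right m x y a y' _ hy' ih =>
    obtain ⟨e, he, hq⟩ := ih
    obtain ⟨i, hi, h1, h2⟩ := h.exists_index y y' hy'
    refine ⟨_, hcode m e (i + D.K) he (by omega), fun q => ?_⟩
    have h3 : (i + D.K + 2 * D.K * q) % (2 * D.K) = i + D.K := by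
      rw [Nat.add_mul_mod_self_left, Nat.mod_eq_of_lt (by omega)]
    have h4 : (i + D.K + 2 * D.K * q) / (2 * D.K) = q := by
      rw [Nat.add_mul_div_left _ _ (by omega), Nat.div_eq_of_lt (by omega), zero_add]
    rw [hsplit, Function.iterate_succ_apply', hq, Tables.move]
    simp only [h3, h4, if_neg (show ¬ i + D.K < D.K by omega), Nat.add_sub_cancel, h1, h2]

end WordRAM

/-! ### Lower and upper bounds for the estimate -/

namespace WordRAM

variable {n : ℕ} {D : Tables} {δ : Fin n → Fin n → ℕ} {N : Fin n → Finset (Fin n)}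

/-- The tables `D` hold the pivots `p` of the vertices, their hubs `piv` and the bunches of the
pivots. -/
structure Tables.Hubs (D : Tables) (δ : Fin n → Fin n → ℕ) (p : Fin n → Fin n)
    (piv : ℕ → Fin n → Fin n) (bunch : Fin n → Finset (Fin n)) : Prop where
  pivot_eq : ∀ x : Fin n, D.pivot x = p x
  radius_eq : ∀ x : Fin n, D.radius x = δ x (p x)
  hub_eq : ∀ i, ∀ x : Fin n, D.hub i x = piv i (p x)
  hubDist_eq : ∀ i, ∀ x : Fin n, D.hubDist i x = δ x (p x) + δ (p x) (piv i (p x))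
  le_look : ∀ v w : Fin n, δ v w ≤ D.look (v * D.n + w)
  look_eq : ∀ x w : Fin n, w ∈ bunch (p x) → D.look (p x * D.n + w) = δ (p x) w

variable {k : ℕ} {p : Fin n → Fin n} {piv : ℕ → Fin n → Fin n} {bunch : Fin n → Finset (Fin n)}

/-- The candidate bounds from above the length of the route from `x` over its pivot, a hub and the
pivot of `y` to `y`. -/
theorem Tables.Hubs.le_cand (h : D.Hubs δ p piv bunch) (hsymm : ∀ u v, δ u v = δ v u)
    (htri : ∀ u v w, δ u w ≤ δ u v + δ v w) (x y : Fin n) (acc i : ℕ) :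
    acc + δ x y ≤ D.cand x y acc i := by
  rw [Tables.cand, h.pivot_eq, h.radius_eq, h.hub_eq, h.hubDist_eq]
  have h1 := h.le_look (p y) (piv i (p x))
  have h2 := htri x (p x) y
  have h3 := htri (p x) (piv i (p x)) y
  have h4 := htri (piv i (p x)) (p y) y
  rw [hsymm (p y) y, hsymm _ (p y)] at h4
  omega

/-- The distance of the pivots is at most `δ x y` plus the two radii. It is stretched by `2k - 1`,
and each radius is travelled once more; this makes the factor `2k` of the radii. -/
theorem Tables.Hubs.cand_le (h : D.Hubs δ p piv bunch) (hsymm : ∀ u v, δ u v = δ v u)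
    (htri : ∀ u v w, δ u w ≤ δ u v + δ v w) (hk : 0 < k) {x y : Fin n} {acc i : ℕ}
    (hb : piv i (p x) ∈ bunch (p y))
    (hd : δ (p x) (piv i (p x)) + δ (piv i (p x)) (p y) + δ (p x) (p y) ≤
      2 * k * δ (p x) (p y)) :
    D.cand x y acc i + δ x y ≤ acc + 2 * k * δ x y + 2 * k * (δ x (p x) + δ y (p y)) := by
  rw [Tables.cand, h.pivot_eq, h.radius_eq, h.hub_eq, h.hubDist_eq, h.look_eq _ _ hb,
    hsymm (p y) (piv i (p x))]
  have h1 : δ (p x) (p y) ≤ δ x (p x) + δ x y + δ y (p y) := by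
    have h2 := htri (p x) x (p y)
    have h3 := htri x y (p y)
    rw [hsymm (p x) x] at h2
    omega
  obtain ⟨j, rfl⟩ : ∃ j, k = j + 1 := ⟨k - 1, by omega⟩
  have h4 : δ (p x) (piv i (p x)) + δ (piv i (p x)) (p y) ≤ (2 * j + 1) * δ (p x) (p y) := by
    have : 2 * (j + 1) * δ (p x) (p y) = (2 * j + 1) * δ (p x) (p y) + δ (p x) (p y) := by ring
    omega
  have h5 := Nat.mul_le_mul_left (2 * j + 1) h1
  have h6 : acc + 2 * (j + 1) * δ x y + 2 * (j + 1) * (δ x (p x) + δ y (p y)) =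
    acc + δ x y + (2 * j + 1) * (δ x (p x) + δ x y + δ y (p y)) + (δ x (p x) + δ y (p y)) := by
    ring
  omega

theorem Tables.le_best_of_hubs (hl : D.Lists δ N) (h : D.Hubs δ p piv bunch)
    (hself : ∀ v, δ v v = 0) (hsymm : ∀ u v, δ u v = δ v u)
    (htri : ∀ u v w, δ u w ≤ δ u v + δ v w) (hinf : ∀ u v, δ u v ≤ D.inf) (M m : ℕ)
    (s t : Fin n) : δ s t ≤ D.best M k s t m := by
  apply D.le_best (hinf s t)
  · intro e he
    obtain ⟨x, y, a, e', hz, hR⟩ := hl.reach s t e M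
    rw [hz] at he ⊢
    have := hR.le hsymm htri
    rw [Fin.ext he, hself] at this
    exact this
  · intro e i _
    obtain ⟨x, y, a, e', hz, hR⟩ := hl.reach s t e M
    rw [hz]
    exact (hR.le hsymm htri).trans (h.le_cand hsymm htri x y a i)
  · intro e i _
    obtain ⟨x, y, a, e', hz, hR⟩ := hl.reach s t e M
    rw [hz]
    refine (hR.le hsymm htri).trans ?_
    rw [hsymm x y]
    exact h.le_cand hsymm htri y x a i

theorem Tables.best_le_of_hubs (hl : D.Lists δ N) (h : D.Hubs δ p piv bunch)
    (hnear : ∀ v, ∀ a ∈ N v, ∀ b, b ∉ N v → δ v a ≤ δ v b)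
    (hmem : ∀ v, v ∈ N v) (hp : ∀ v, p v ∈ N v) (hself : ∀ v, δ v v = 0)
    (hsymm : ∀ u v, δ u v = δ v u) (htri : ∀ u v w, δ u w ≤ δ u v + δ v w) (hk : 0 < k)
    (hhub : ∀ x y, ∃ i < k,
      (piv i (p x) ∈ bunch (p y) ∧ δ (p x) (piv i (p x)) + δ (piv i (p x)) (p y) +
        δ (p x) (p y) ≤ 2 * k * δ (p x) (p y)) ∨
      (piv i (p y) ∈ bunch (p x) ∧ δ (p y) (piv i (p y)) + δ (piv i (p y)) (p x) +
        δ (p x) (p y) ≤ 2 * k * δ (p x) (p y)))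
    {M Q g E INF : ℕ} (hM : 2 * g + 2 ≤ M)
    (hcross : ∀ x y, δ x y < INF → ∀ S : Finset (Fin n), x ∈ S → y ∉ S → ∃ u ∈ S, ∃ u' ∉ S,
      ∃ ω ≤ Q, δ u u' ≤ ω ∧ δ x u + ω + δ u' y ≤ δ x y) {s t : Fin n}
    (hsmall : ∀ r ≤ Q, r ≤ δ s t → g * r ≤ δ s t + E) (hd : δ s t < INF) :
    ∃ a b, g * a ≤ δ s t + E ∧ g * b ≤ δ s t + E ∧
      D.best M k s t ((2 * D.K) ^ M) + δ s t ≤ 2 * k * δ s t + 2 * k * (a + b) := by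
  classical
  obtain ⟨x, y, acc, hR, hacc, hgood⟩ := Reach.exists_good hnear hmem hp hself hsymm htri hcross
    hsmall hd M g 0 s t 0 Reach.start (by omega) le_rfl (by split_ifs <;> omega)
  rw [zero_add] at hR
  obtain ⟨e, he, hz⟩ := hl.exists_code hR
  have hz := hz 0
  rw [Nat.mul_zero, add_zero] at hz
  -- Only `δ x y` is stretched, while the moves `acc` are travelled at their true length; together
  -- this is no worse than stretching all of `δ s t`.
  have hbase : acc + 2 * k * δ x y + δ s t ≤ 2 * k * δ s t + δ x y := by
    obtain ⟨j, rfl⟩ : ∃ j, k = j + 1 := ⟨k - 1, by omega⟩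
    have h1 : 2 * j * δ x y ≤ 2 * j * δ s t := Nat.mul_le_mul_left _ (by omega)
    have h2 : ∀ z, 2 * (j + 1) * z = 2 * j * z + 2 * z := fun z => by ring
    rw [h2, h2]
    omega
  rcases hgood with rfl | ⟨hx, hy⟩
  · refine ⟨0, 0, by omega, by omega, ?_⟩
    have h1 := D.best_le_of_eq M k s t he (by rw [hz])
    rw [hz] at h1
    rw [hself] at hbase hacc
    simp only at h1
    omega
  · refine ⟨_, _, hx, hy, ?_⟩
    obtain ⟨i, hi, ⟨hb, hdist⟩ | ⟨hb, hdist⟩⟩ := hhub x y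
    · have h1 := D.best_le_cand M k s t he hi
      rw [hz] at h1
      have h2 := h.cand_le hsymm htri hk (acc := acc) hb hdist
      simp only at h1
      omega
    · have h1 := D.best_le_cand_swap M k s t he hi
      rw [hz] at h1
      rw [hsymm (p x) (p y)] at hdist
      have h2 := h.cand_le hsymm htri hk (acc := acc) hb hdist
      rw [hsymm y x, add_comm (δ y (p y))] at h2
      simp only at h1
      omega

/-! ### Construction of the tables from a semimetric -/

theorem exists_tables {n k K H L M S b J INF scale : ℕ} (hn : 0 < n) (hk : 0 < k) (hK : 0 < K)
    (hKn : K ≤ n) (hH : 1 ≤ H) (hL : 1 ≤ L) (hnL : n ≤ 2 ^ L) (hBH : n * L / K + 1 ≤ H ^ k)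
    (hS7 : 7 ≤ S) (hSK : n * K ≤ S) (hSm : (n * L / K + 1) * (2 * k * H * (3 * L) ^ k) ≤ S)
    (hJ : n * n ≤ 2 ^ J) (hM : 0 < M) (hbS : (2 * k + 7) * S ≤ 2 ^ b)
    (hbinf : (M + 4) * INF < 2 ^ b) (hbn : n * n < 2 ^ b) (hbK : (2 * K) ^ M < 2 ^ b)
    (hscale : scale ≤ INF) (δ : Fin n → Fin n → ℕ) (hself : ∀ v, δ v v = 0)
    (hsymm : ∀ u v, δ u v = δ v u) (htri : ∀ u v w, δ u w ≤ δ u v + δ v w)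
    (hinf : ∀ u v, δ u v ≤ INF) :
    ∃ D : Tables, D.n = n ∧ D.K = K ∧ D.inf = INF ∧ D.scale = scale ∧ D.Fits b M k S J ∧
      (∀ x ∈ D.words M k S, x < 2 ^ b) ∧ ∀ s t : Fin n,
        δ s t ≤ D.best M k s t ((2 * K) ^ M) ∧
        ∀ Q g E, 2 * g + 2 ≤ M →
          (∀ x y, δ x y < INF → ∀ S : Finset (Fin n), x ∈ S → y ∉ S → ∃ u ∈ S, ∃ u' ∉ S,
            ∃ ω ≤ Q, δ u u' ≤ ω ∧ δ x u + ω + δ u' y ≤ δ x y) →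
          (∀ r ≤ Q, r ≤ δ s t → g * r ≤ δ s t + E) → δ s t < INF →
          ∃ a b, g * a ≤ δ s t + E ∧ g * b ≤ δ s t + E ∧
            D.best M k s t ((2 * K) ^ M) + δ s t ≤ 2 * k * δ s t + 2 * k * (a + b) := by
  classical
  -- near sets
  choose N hNsub hNcard hN using fun v : Fin n => Finset.exists_nearest (Finset.univ : Finset (Fin n))
    (fun u => if u = v then 0 else δ v u + 1) (K := K) (by simpa using hKn)
  have hmem : ∀ v, v ∈ N v := by
    intro v
    by_contra hv
    obtain ⟨a, ha⟩ := Finset.card_pos.1 (hK.trans_le (hNcard v).ge)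
    have h1 := hN v a ha v (Finset.mem_univ _) hv
    have h2 : a ≠ v := fun h => hv (h ▸ ha)
    simp [h2] at h1
  have hnear : ∀ v, ∀ a ∈ N v, ∀ b, b ∉ N v → δ v a ≤ δ v b := by
    intro v a ha b hb
    have h1 := hN v a ha b (Finset.mem_univ _) hb
    have h2 : b ≠ v := fun h => hb (h ▸ hmem v)
    rcases eq_or_ne a v with rfl | h3
    · rw [hself]; exact Nat.zero_le _
    · simpa [h2, h3] using h1
  -- pivots
  obtain ⟨B, -, hBcard, hBhit⟩ := Finset.exists_hitting Finset.univ N hK hNsub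
    (fun v => (hNcard v).ge) (L := L) (by simpa using hnL)
  rw [Finset.card_univ, Fintype.card_fin] at hBcard
  choose p hpB hpN using hBhit
  have hBne : B.Nonempty := ⟨_, hpB ⟨0, hn⟩⟩
  have hBn : B.card ≤ n := by simpa using Finset.card_le_univ B
  -- hubs
  obtain ⟨piv, bunch, hbcard, hbB, hpivB, hhub⟩ := exists_hubs δ hself hsymm htri B hk hH hL
    (hBn.trans hnL) hBne (hBcard.trans hBH)
  -- the dictionary
  let keys : Finset ℕ := B.biUnion fun v => (bunch v).image fun w : Fin n => (v : ℕ) * n + (w : ℕ)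
  have hkeys : ∀ q, q ∈ keys ↔ ∃ v ∈ B, ∃ w ∈ bunch v, (v : ℕ) * n + w = q := by
    intro q
    simp [keys]
  have hkeyslt : ∀ q ∈ keys, q < n * n := by
    intro q hq
    obtain ⟨v, _, w, _, rfl⟩ := (hkeys q).1 hq
    exact index_lt v.2 w.2
  have hkeyscard : keys.card ≤ S := by
    have h1 : ∀ v ∈ B, ((bunch v).image fun w : Fin n => (v : ℕ) * n + (w : ℕ)).card ≤
        2 * k * H * (3 * L) ^ k := fun v hv => Finset.card_image_le.trans (hbcard v hv)
    refine (Finset.card_biUnion_le.trans (Finset.sum_le_card_nsmul _ _ _ h1)).trans ?_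
    rw [smul_eq_mul]
    exact (Nat.mul_le_mul_right _ hBcard).trans hSm
  -- Binary search needs a nonempty dictionary; the hub property of a pivot with itself supplies a
  -- key.
  have hkeyspos : 0 < keys.card := by
    obtain ⟨v, hv⟩ := hBne
    obtain ⟨i, -, h⟩ := hhub v hv v hv
    have : piv i v ∈ bunch v := by
      rcases h with h | h <;> exact h.1
    exact Finset.card_pos.2 ⟨_, (hkeys _).2 ⟨v, hv, _, this, rfl⟩⟩
  have hkeyspow : keys.card ≤ 2 ^ J := by
    have : keys ⊆ Finset.range (n * n) := fun q hq => Finset.mem_range.2 (hkeyslt q hq)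
    have := Finset.card_le_card this
    rw [Finset.card_range] at this
    exact this.trans hJ
  obtain ⟨key, hkeymono, hkeymem, hkeyor⟩ := keys.exists_increasing
  choose nb hnbN hnb using fun v : Fin n => (N v).exists_enumeration hK (hNcard v)
  let vtx : ℕ → Fin n := fun i => ⟨i % n, Nat.mod_lt _ hn⟩
  have hvtx : ∀ v : Fin n, vtx v = v := fun v => Fin.ext (Nat.mod_eq_of_lt v.2)
  let D : Tables :=
    { n := n
      K := K
      m := keys.card
      inf := INF
      scale := scale
      ballVertex := fun a => nb (vtx (a / K)) (a % K)
      ballDist := fun a => δ (vtx (a / K)) (nb (vtx (a / K)) (a % K))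
      pivot := fun v => p (vtx v)
      radius := fun v => δ (vtx v) (p (vtx v))
      key := key
      value := fun q => δ (vtx (q / n)) (vtx (q % n))
      hub := fun i v => piv i (p (vtx v))
      hubDist := fun i v => δ (vtx v) (p (vtx v)) + δ (p (vtx v)) (piv i (p (vtx v))) }
  have hpair : ∀ v w : Fin n, vtx (((v : ℕ) * n + w) / n) = v ∧ vtx (((v : ℕ) * n + w) % n) = w := by
    intro v w
    have h1 : ((v : ℕ) * n + w) / n = v := by
      rw [mul_comm, Nat.mul_add_div hn, Nat.div_eq_of_lt w.2, add_zero]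
    have h2 : ((v : ℕ) * n + w) % n = w := by
      rw [mul_comm, Nat.mul_add_mod, Nat.mod_eq_of_lt w.2]
    rw [h1, h2]
    exact ⟨hvtx v, hvtx w⟩
  have hnX : n < 2 ^ b := (Nat.le_mul_of_pos_left n hn).trans_lt hbn
  have hS2 : 7 * S ≤ 2 ^ b := (Nat.mul_le_mul_right S (by omega)).trans hbS
  have hinf2 : 4 * INF < 2 ^ b := (Nat.mul_le_mul_right INF (by omega)).trans_lt hbinf
  have hfits : D.Fits b M k S J := by
    constructor
    · omega
    · exact hS7
    · exact hbS
    · exact hkeyspos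
    · exact hkeyscard
    · exact hkeyspow
    · exact hkeymono
    · exact hK
    · exact hSK
    · exact fun i _ => (nb _ _).2
    · exact fun i _ => hinf _ _
    · exact fun i _ => (p _).2
    · exact fun i _ => hinf _ _
    · exact fun i _ j _ => (piv j _).2
    · intro i _ j _
      have h1 := hinf (vtx i) (p (vtx i))
      have h2 := hinf (p (vtx i)) (piv j (p (vtx i)))
      change δ _ _ + δ _ _ ≤ 2 * INF
      omega
    · exact fun i _ => hinf _ _
    · exact hbinf
    · exact hbn
    · exact hbK
  have hlists : D.Lists δ N := by
    have hidx : ∀ (x : Fin n), ∀ i < K, vtx (((x : ℕ) * K + i) / K) = x ∧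
        ((x : ℕ) * K + i) % K = i := by
      intro x i hi
      have h1 : ((x : ℕ) * K + i) / K = x := by
        rw [mul_comm, Nat.mul_add_div hK, Nat.div_eq_of_lt hi, add_zero]
      have h2 : ((x : ℕ) * K + i) % K = i := by
        rw [mul_comm, Nat.mul_add_mod, Nat.mod_eq_of_lt hi]
      rw [h1, h2]
      exact ⟨hvtx x, rfl⟩
    refine ⟨hK, fun x i hi => ⟨nb x i, hnbN x i, ?_, ?_⟩, fun x a ha => ?_⟩
    · simp only [D, hidx x i hi]
    · simp only [D, hidx x i hi]
    · obtain ⟨i, hi, rfl⟩ := hnb x a ha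
      refine ⟨i, hi, ?_, ?_⟩
      · simp only [D, hidx x i hi]
      · simp only [D, hidx x i hi]
  have hhubs : D.Hubs δ p piv bunch := by
    constructor
    · intro x; simp only [D, hvtx]
    · intro x; simp only [D, hvtx]
    · intro i x; simp only [D, hvtx]
    · intro i x; simp only [D, hvtx]
    · intro v w
      unfold Tables.look
      split_ifs
      · simp only [D, hpair v w, le_refl]
      · exact hinf v w
    · intro x w hw
      unfold Tables.look
      rw [if_pos]
      · simp only [D, hpair (p x) w]
      · exact (hkeymem _).1 ((hkeys _).2 ⟨p x, hpB x, w, hw, rfl⟩)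
  refine ⟨D, rfl, rfl, rfl, rfl, hfits, ?_, fun s t => ⟨?_, fun Q g E hM' hcross hsmall hd => ?_⟩⟩
  · intro x hx
    obtain ⟨a, -, rfl⟩ := List.mem_map.1 hx
    generalize a % (2 * k + 7) = j
    generalize a / (2 * k + 7) = i
    have h2K : 2 * K < 2 ^ b := (Nat.le_self_pow hM.ne' _).trans_lt hbK
    have hδ : ∀ u v, δ u v < 2 ^ b := fun u v => by have := hinf u v; omega
    match j with
    | 0 =>
      match i with
      | 0 => exact hbK
      | 1 => change K < _; omega
      | 2 => exact hnX
      | 3 => change keys.card < _; omega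
      | 4 => change INF < _; omega
      | 5 => exact h2K
      | 6 => change scale < _; omega
      | i + 7 => exact Nat.two_pow_pos b
    | 1 => exact (nb _ _).2.trans hnX
    | 2 => exact hδ _ _
    | 3 => exact (p _).2.trans hnX
    | 4 => exact hδ _ _
    | 5 =>
      rcases hkeyor i with h | h
      · exact (hkeyslt _ h).trans hbn
      · change key i < _
        rw [h]; exact Nat.two_pow_pos b
    | 6 => exact hδ _ _
    | j + 7 =>
      simp only [Tables.entry]
      split_ifs
      · exact (piv _ _).2.trans hnX
      · have h1 := hinf (vtx i) (p (vtx i))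
        have h2 := hinf (p (vtx i)) (piv (j / 2) (p (vtx i)))
        change δ _ _ + δ _ _ < _
        omega
  · exact Tables.le_best_of_hubs hlists hhubs hself hsymm htri hinf M _ s t
  · exact Tables.best_le_of_hubs hlists hhubs hnear hmem hpN hself hsymm htri hk
      (fun x y => hhub _ (hpB x) _ (hpB y)) hM' hcross hsmall hd

end WordRAM

/-! ### Rounding of the weights -/

section Rounding

variable {V : Type*} {G : SimpleGraph V} {w : Sym2 V → ℝ≥0} {W : ℝ≥0} {Q : ℕ}

/-- The weights in units of `W / Q`, rounded up. -/
noncomputable def roundedWeight (w : Sym2 V → ℝ≥0) (W : ℝ≥0) (Q : ℕ) (e : Sym2 V) : ℕ :=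
  ⌈(Q : ℝ≥0) * w e / W⌉₊

theorem roundedWeight_le (hw : ∀ e ∈ G.edgeSet, w e ≤ W) {e : Sym2 V} (he : e ∈ G.edgeSet) :
    roundedWeight w W Q e ≤ Q := by
  refine Nat.ceil_le.2 ?_
  exact div_le_of_le_mul₀ zero_le zero_le (mul_le_mul_right (hw e he) _)

theorem le_roundedWeight (hw : ∀ e ∈ G.edgeSet, w e ≤ W) {e : Sym2 V} (he : e ∈ G.edgeSet) :
    Q * w e ≤ roundedWeight w W Q e * W := by
  rcases eq_or_ne W 0 with rfl | hW
  · have := hw e he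
    simp_all
  · rw [← div_le_iff₀ (pos_iff_ne_zero.2 hW)]
    exact Nat.le_ceil _

theorem roundedWeight_mul_le (e : Sym2 V) : roundedWeight w W Q e * W ≤ Q * w e + W := by
  rcases eq_or_ne W 0 with rfl | hW
  · simp
  · calc roundedWeight w W Q e * W ≤ (Q * w e / W + 1) * W :=
          mul_le_mul_left (Nat.ceil_lt_add_one zero_le).le _
      _ = Q * w e + W := by rw [add_mul, div_mul_cancel₀ _ hW, one_mul]

theorem sum_le_weight (hw : ∀ e ∈ G.edgeSet, w e ≤ W) {s t : V} (p : G.Walk s t) :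
    Q * (p.edges.map w).sum ≤ p.weight (roundedWeight w W Q) * W := by
  induction p with
  | nil => simp [SimpleGraph.Walk.weight]
  | cons h p ih =>
    simp only [SimpleGraph.Walk.weight, SimpleGraph.Walk.edges_cons, List.map_cons, List.sum_cons,
      Nat.cast_add, mul_add, add_mul] at ih ⊢
    exact add_le_add (le_roundedWeight hw h) ih

theorem weight_le_sum {s t : V} (p : G.Walk s t) :
    p.weight (roundedWeight w W Q) * W ≤ Q * (p.edges.map w).sum + p.length * W := by
  induction p with
  | nil => simp [SimpleGraph.Walk.weight]
  | @cons a b c h p ih =>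
    simp only [SimpleGraph.Walk.weight, SimpleGraph.Walk.edges_cons, List.map_cons, List.sum_cons,
      Nat.cast_add, mul_add, add_mul, SimpleGraph.Walk.length_cons, Nat.cast_one, one_mul] at ih ⊢
    have := roundedWeight_mul_le (w := w) (W := W) (Q := Q) s(a, b)
    calc _ ≤ (Q * w s(a, b) + W) + _ := add_le_add this ih
      _ = _ := by ring

theorem weight_le_length_mul (hw : ∀ e ∈ G.edgeSet, w e ≤ W) {s t : V} (p : G.Walk s t) :
    p.weight (roundedWeight w W Q) ≤ p.length * Q := by
  induction p with
  | nil => simp [SimpleGraph.Walk.weight]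
  | @cons a b c h p ih =>
    simp only [SimpleGraph.Walk.weight, SimpleGraph.Walk.edges_cons, List.map_cons, List.sum_cons,
      SimpleGraph.Walk.length_cons, add_mul, one_mul] at ih ⊢
    have := roundedWeight_le (Q := Q) hw (e := s(a, b)) h
    omega

-- Rounding costs up to one unit per edge, so the walk has to be shortened to at most `n` edges.
open Classical in
theorem exists_path_sum_le [Fintype V] {s t : V} (p : G.Walk s t) :
    ∃ q : G.Walk s t, q.length ≤ Fintype.card V ∧ (q.edges.map w).sum ≤ (p.edges.map w).sum := by
  refine ⟨p.bypass, (p.bypass_isPath).length_lt.le, ?_⟩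
  exact (p.edges_bypass_sublist_edges.map w).sum_le_sum fun _ _ => zero_le

end Rounding

/-- An estimate of the rounded distance yields an estimate of the distance. -/
theorem weightedDist_estimate {n k ℓ Q INF best x y : ℕ} (hk : 0 < k) (hℓ : 0 < ℓ) (hn : 0 < n)
    (hQ : Q = 4 * k * ℓ * n) (hINF : INF = 6 * k * n * Q + 1) {W : ℝ≥0}
    {G : SimpleGraph (Fin n)} {w : Sym2 (Fin n) → ℝ≥0} (hw : ∀ e ∈ G.edgeSet, w e ≤ W)
    {s t : Fin n} (hlow : G.cappedDist (roundedWeight w W Q) INF s t ≤ best)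
    (hupp : G.cappedDist (roundedWeight w W Q) INF s t < INF →
      ℓ * best + ℓ * G.cappedDist (roundedWeight w W Q) INF s t + 2 * k * ℓ * n ≤
      2 * k * ℓ * G.cappedDist (roundedWeight w W Q) INF s t +
        G.cappedDist (roundedWeight w W Q) INF s t + 4 * k * ℓ * Q)
    (hxy : if best < INF then x = best ∧ y = Q else y = 0) :
    weightedDist G w s t ≤ decodeEstimate W x y ∧
      decodeEstimate W x y ≤ ENNReal.ofReal (2 * (k : ℝ) - 1 + 1 / (ℓ : ℝ)) * weightedDist G w s t +
        4 * (k : ℝ≥0∞) * (W : ℝ≥0∞) := by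
  set δ := G.cappedDist (roundedWeight w W Q) INF s t with hδ
  have hQpos : 0 < Q := by rw [hQ]; positivity
  have hQ' : (0 : ℝ≥0) < Q := by exact_mod_cast hQpos
  have hkR : (1 : ℝ) ≤ k := by exact_mod_cast hk
  have hℓR : (1 : ℝ) ≤ ℓ := by exact_mod_cast hℓ
  have hα : 0 < 2 * (k : ℝ) - 1 + 1 / (ℓ : ℝ) := by
    have : 0 < 1 / (ℓ : ℝ) := by positivity
    linarith
  constructor
  · by_cases hb : best < INF
    · rw [if_pos hb] at hxy
      obtain ⟨rfl, rfl⟩ := hxy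
      obtain ⟨p, hp⟩ := SimpleGraph.exists_weight_eq_cappedDist _ _ (hlow.trans_lt hb)
      refine (iInf_le _ p).trans ?_
      rw [decodeEstimate, if_neg hQpos.ne', ENNReal.coe_le_coe, div_mul_eq_mul_div,
        le_div_iff₀ hQ', mul_comm]
      refine (sum_le_weight hw p).trans (mul_le_mul_left ?_ _)
      rw [hp]
      exact_mod_cast hlow
    · rw [if_neg hb] at hxy
      simp [decodeEstimate, hxy]
  · rw [weightedDist, ENNReal.mul_iInf_of_ne (by simpa using hα) ENNReal.ofReal_ne_top,
      ENNReal.iInf_add]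
    refine le_iInf fun p => ?_
    obtain ⟨q, hq, hsum⟩ := exists_path_sum_le (w := w) p
    rw [Fintype.card_fin] at hq
    have h1 : δ ≤ n * Q := (SimpleGraph.cappedDist_le_weight _ _ q).trans
      ((weight_le_length_mul hw q).trans (Nat.mul_le_mul_right _ hq))
    have hδlt : δ < INF := by
      rw [hINF]
      have : n * Q ≤ 6 * k * n * Q := by
        rw [mul_assoc (6 * k)]
        exact Nat.le_mul_of_pos_left _ (by omega)
      omega
    have h2 := hupp hδlt
    -- `INF` is chosen for this: a connected pair has `δ ≤ n * Q`, hence an estimate of at most `2kn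
    -- * Q + 4kn * Q`, and is never reported as disconnected.
    have hb : best < INF := by
      have h3 : ℓ * best ≤ ℓ * (6 * k * n * Q) := by
        have e1 : 2 * k * ℓ * δ ≤ 2 * k * ℓ * (n * Q) := Nat.mul_le_mul_left _ h1
        have e2 : δ ≤ ℓ * δ := Nat.le_mul_of_pos_left _ hℓ
        have e3 : 4 * k * ℓ * Q ≤ 4 * k * ℓ * (n * Q) :=
          Nat.mul_le_mul_left _ (Nat.le_mul_of_pos_left _ hn)
        have e4 : ℓ * (6 * k * n * Q) = 2 * k * ℓ * (n * Q) + 4 * k * ℓ * (n * Q) := by ring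
        omega
      rw [hINF]
      exact Nat.lt_succ_of_le (Nat.le_of_mul_le_mul_left h3 hℓ)
    rw [if_pos hb] at hxy
    obtain ⟨rfl, rfl⟩ := hxy
    have h4 : (δ : ℝ≥0) * W ≤ y * (p.edges.map w).sum + n * W := by
      have a1 : (δ : ℝ≥0) ≤ (q.weight (roundedWeight w W y) : ℕ) := by
        exact_mod_cast SimpleGraph.cappedDist_le_weight _ _ q
      have a2 : (q.length : ℝ≥0) ≤ n := by exact_mod_cast hq
      calc (δ : ℝ≥0) * W ≤ q.weight (roundedWeight w W y) * W := mul_le_mul_left a1 _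
        _ ≤ _ := weight_le_sum q
        _ ≤ _ := add_le_add (mul_le_mul_right hsum _) (mul_le_mul_left a2 _)
    generalize (p.edges.map w).sum = σ at h4 ⊢
    rw [decodeEstimate, if_neg hQpos.ne', ENNReal.ofReal]
    have h5 : (4 : ℝ≥0∞) * (k : ℝ≥0∞) * (W : ℝ≥0∞) = ((4 * k * W : ℝ≥0) : ℝ≥0∞) := by
      push_cast; rfl
    rw [h5, ← ENNReal.coe_mul, ← ENNReal.coe_add, ENNReal.coe_le_coe, div_mul_eq_mul_div,
      div_le_iff₀ hQ', ← NNReal.coe_le_coe]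
    push_cast [Real.coe_toNNReal _ hα.le]
    have h4' : (δ : ℝ) * W ≤ y * σ + n * W := by exact_mod_cast h4
    have h2' : (ℓ : ℝ) * x + ℓ * δ + 2 * k * ℓ * n ≤ 2 * k * ℓ * δ + δ + 4 * k * ℓ * y := by
      exact_mod_cast h2
    have hW : (0 : ℝ) ≤ W := W.2
    set α := 2 * (k : ℝ) - 1 + 1 / (ℓ : ℝ) with hαdef
    have hα2 : α ≤ 2 * k := by
      have : 1 / (ℓ : ℝ) ≤ 1 := by rw [div_le_one (by positivity)]; exact hℓR
      linarith
    -- The term `- 2 * k * n` pays for the rounding error `n * W` in `h4`, which is multiplied by `α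
    -- ≤ 2 * k`.
    have h6 : (x : ℝ) ≤ α * δ + 4 * k * y - 2 * k * n := by
      have hℓα : (ℓ : ℝ) * α = 2 * k * ℓ - ℓ + 1 := by
        rw [hαdef]; field_simp
      have : (ℓ : ℝ) * x ≤ ℓ * (α * δ + 4 * k * y - 2 * k * n) := by
        calc (ℓ : ℝ) * x ≤ (2 * k * ℓ - ℓ + 1) * δ + 4 * k * ℓ * y - 2 * k * ℓ * n := by linarith
          _ = _ := by rw [← hℓα]; ring
      exact le_of_mul_le_mul_left this (by linarith)
    calc (x : ℝ) * W ≤ (α * δ + 4 * k * y - 2 * k * n) * W := mul_le_mul_of_nonneg_right h6 hW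
      _ = α * (δ * W) + 4 * k * y * W - 2 * k * (n * W) := by ring
      _ ≤ α * (y * σ + n * W) + 4 * k * y * W - 2 * k * (n * W) := by
        have := mul_le_mul_of_nonneg_left h4' hα.le
        linarith
      _ ≤ α * (y * σ + n * W) + 4 * k * y * W - α * (n * W) := by
        have := mul_le_mul_of_nonneg_right hα2 (mul_nonneg (Nat.cast_nonneg n) hW)
        linarith
      _ = (α * σ + 4 * k * W) * y := by ring

/-! ### The size of the words -/

/-- The function `f` is bounded by a power of `2 ^ Nat.size n`, so that its values fit into words of
`O(Nat.size n)` bits. -/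
def FitsWords (f : ℕ → ℕ) : Prop := ∃ a, ∀ n, 0 < n → f n ≤ 2 ^ (a * Nat.size n)

namespace FitsWords

variable {f g : ℕ → ℕ}

theorem one_le_size {n : ℕ} (hn : 0 < n) : 1 ≤ Nat.size n := Nat.size_pos.2 hn

theorem mono (hf : FitsWords f) (h : ∀ n, 0 < n → g n ≤ f n) : FitsWords g := by
  obtain ⟨a, ha⟩ := hf
  exact ⟨a, fun n hn => (h n hn).trans (ha n hn)⟩

theorem const (c : ℕ) : FitsWords fun _ => c :=
  ⟨c, fun n hn => Nat.lt_two_pow_self.le.trans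
    (Nat.pow_le_pow_right (by norm_num) (Nat.le_mul_of_pos_right _ (one_le_size hn)))⟩

theorem id : FitsWords fun n => n :=
  ⟨1, fun n _ => by rw [one_mul]; exact (Nat.lt_size_self n).le⟩

theorem size : FitsWords Nat.size :=
  ⟨1, fun n _ => by rw [one_mul]; exact Nat.lt_two_pow_self.le⟩

theorem mul (hf : FitsWords f) (hg : FitsWords g) : FitsWords fun n => f n * g n := by
  obtain ⟨a, ha⟩ := hf
  obtain ⟨b, hb⟩ := hg
  refine ⟨a + b, fun n hn => ?_⟩
  rw [add_mul, pow_add]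
  exact Nat.mul_le_mul (ha n hn) (hb n hn)

theorem add (hf : FitsWords f) (hg : FitsWords g) : FitsWords fun n => f n + g n := by
  obtain ⟨a, ha⟩ := hf
  obtain ⟨b, hb⟩ := hg
  refine ⟨a + b + 1, fun n hn => ?_⟩
  have h1 := ha n hn
  have h2 := hb n hn
  have h3 : 2 ^ (a * Nat.size n) ≤ 2 ^ ((a + b) * Nat.size n) :=
    Nat.pow_le_pow_right (by norm_num) (Nat.mul_le_mul_right _ (by omega))
  have h4 : 2 ^ (b * Nat.size n) ≤ 2 ^ ((a + b) * Nat.size n) :=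
    Nat.pow_le_pow_right (by norm_num) (Nat.mul_le_mul_right _ (by omega))
  have h5 : 2 ^ ((a + b) * Nat.size n) * 2 ≤ 2 ^ ((a + b + 1) * Nat.size n) := by
    rw [← pow_succ]
    refine Nat.pow_le_pow_right (by norm_num) ?_
    rw [Nat.succ_mul]
    have := one_le_size hn
    omega
  change f n + g n ≤ _
  omega

theorem pow (hf : FitsWords f) (m : ℕ) : FitsWords fun n => f n ^ m := by
  induction m with
  | zero => simpa using const 1
  | succ m ih => simpa only [pow_succ] using ih.mul hf

end FitsWords

/-! ### The parameters of the oracle -/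

namespace OracleParams

/-- The size of the near sets. -/
noncomputable def near (y : ℝ) (n : ℕ) : ℕ := ⌈(n : ℝ) ^ y⌉₊

/-- A bound for the number of pivots. -/
noncomputable def pivots (y : ℝ) (n : ℕ) : ℕ := n * Nat.size n / near y n + 1

/-- The size of the near sets among the hubs of one level. -/
noncomputable def level (k : ℕ) (y : ℝ) (n : ℕ) : ℕ := ⌈(pivots y n : ℝ) ^ (1 / (k : ℝ))⌉₊

/-- The length of the tables. -/
noncomputable def length (k : ℕ) (y : ℝ) (n : ℕ) : ℕ :=
  n * near y n + pivots y n * (2 * k * level k y n * (3 * Nat.size n) ^ k) + 7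

/-- The query time with `M` moves. -/
noncomputable def time (k M : ℕ) (y : ℝ) (n : ℕ) : ℕ :=
  (2 * near y n) ^ M * (20 * M + 2 * k * (13 * (2 * Nat.size n) + 41) + 28) + 48

variable {k : ℕ} {y : ℝ} {n : ℕ}

theorem rpow_le_near : (n : ℝ) ^ y ≤ near y n := Nat.le_ceil _

theorem near_pos (hn : 0 < n) : 0 < near y n :=
  Nat.ceil_pos.2 (Real.rpow_pos_of_pos (by exact_mod_cast hn) _)

theorem near_le (hn : 0 < n) (hy : y ≤ 1) : near y n ≤ n := by
  refine Nat.ceil_le.2 ?_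
  calc (n : ℝ) ^ y ≤ (n : ℝ) ^ (1 : ℝ) :=
        Real.rpow_le_rpow_of_exponent_le (by exact_mod_cast hn) hy
    _ = n := Real.rpow_one _

theorem near_le_rpow (hn : 0 < n) (hy : 0 ≤ y) : (near y n : ℝ) ≤ 2 * (n : ℝ) ^ y := by
  have h1 : 1 ≤ (n : ℝ) ^ y := Real.one_le_rpow (by exact_mod_cast hn) hy
  have h2 : (near y n : ℝ) < (n : ℝ) ^ y + 1 := Nat.ceil_lt_add_one (by positivity)
  linarith

theorem pivots_pos : 0 < pivots y n := Nat.succ_pos _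

theorem pivots_le_level_pow (hk : 0 < k) : pivots y n ≤ level k y n ^ k := by
  have h1 : (pivots y n : ℝ) ^ (1 / (k : ℝ)) ≤ level k y n := Nat.le_ceil _
  have h2 : ((pivots y n : ℝ) ^ (1 / (k : ℝ))) ^ k = pivots y n := by
    rw [one_div, Real.rpow_inv_natCast_pow (Nat.cast_nonneg _) hk.ne']
  have h3 : (pivots y n : ℝ) ≤ (level k y n : ℝ) ^ k := by
    rw [← h2]
    exact pow_le_pow_left₀ (by positivity) h1 k
  exact_mod_cast h3

theorem level_pos : 0 < level k y n :=
  Nat.ceil_pos.2 (Real.rpow_pos_of_pos (by exact_mod_cast pivots_pos) _)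

theorem level_le (hk : 0 < k) : level k y n ≤ pivots y n := by
  refine Nat.ceil_le.2 ?_
  have h1 : (1 : ℝ) ≤ pivots y n := by exact_mod_cast pivots_pos
  calc (pivots y n : ℝ) ^ (1 / (k : ℝ)) ≤ (pivots y n : ℝ) ^ (1 : ℝ) :=
        Real.rpow_le_rpow_of_exponent_le h1 (by
          rw [div_le_one (by exact_mod_cast hk)]; exact_mod_cast hk)
    _ = _ := Real.rpow_one _

theorem fitsWords_near (hy : y ≤ 1) : FitsWords (near y) :=
  FitsWords.id.mono fun _ hn => near_le hn hy

theorem fitsWords_pivots : FitsWords (pivots y) :=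
  ((FitsWords.id.mul .size).add (.const 1)).mono fun _ _ =>
    Nat.add_le_add_right (Nat.div_le_self _ _) _

theorem fitsWords_length (hk : 0 < k) (hy : y ≤ 1) : FitsWords (length k y) :=
  (((FitsWords.id.mul (fitsWords_near hy)).add (fitsWords_pivots.mul
    (((FitsWords.const (2 * k)).mul (fitsWords_pivots.mono fun _ _ => level_le hk)).mul
      (((FitsWords.const 3).mul .size).pow k)))).add (.const 7))

theorem size_le_log (hn : 2 ≤ n) : (Nat.size n : ℝ) ≤ 4 * Real.log n := by
  have hpos : 1 ≤ Nat.size n := FitsWords.one_le_size (by omega)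
  have h1 : 2 ^ (Nat.size n - 1) ≤ n := Nat.lt_size.1 (by omega)
  have h2 : ((Nat.size n : ℝ) - 1) * Real.log 2 ≤ Real.log n := by
    rw [← Nat.cast_one, ← Nat.cast_sub hpos, ← Real.log_pow]
    exact Real.log_le_log (by positivity) (by exact_mod_cast h1)
  have h3 : Real.log 2 ≤ Real.log n := Real.log_le_log (by norm_num) (by exact_mod_cast hn)
  have h4 := Real.log_two_gt_d9
  have h5 : (1 : ℝ) ≤ Nat.size n := by exact_mod_cast hpos
  nlinarith

/-- The product is of order `pivots ^ (1 + 1/k)` with `pivots` at most `2 * Nat.size n * n ^ (1 -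
y)`. Since `1 + 1/k ≤ 2`, the logarithmic factor enters at most squared. -/
theorem pivots_mul_level_le (hk : 0 < k) (hy : y ≤ 1) (hn : 0 < n) :
    (pivots y n : ℝ) * level k y n ≤
      8 * (Nat.size n : ℝ) ^ 2 * (n : ℝ) ^ ((1 - y) * (1 + 1 / (k : ℝ))) := by
  have hnR : (1 : ℝ) ≤ n := by exact_mod_cast hn
  have hnpos : (0 : ℝ) < n := by linarith
  have hL : (1 : ℝ) ≤ Nat.size n := by exact_mod_cast FitsWords.one_le_size hn
  have hkR : (1 : ℝ) ≤ k := by exact_mod_cast hk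
  have hk1 : 1 / (k : ℝ) ≤ 1 := by rw [div_le_one (by linarith)]; exact hkR
  have hk0 : 0 < 1 / (k : ℝ) := by positivity
  have h1 : 1 ≤ (n : ℝ) ^ (1 - y) := Real.one_le_rpow hnR (by linarith)
  have hN : (pivots y n : ℝ) ≤ 2 * Nat.size n * (n : ℝ) ^ (1 - y) := by
    have h2 : ((n * Nat.size n / near y n : ℕ) : ℝ) ≤ Nat.size n * (n : ℝ) ^ (1 - y) := by
      refine Nat.cast_div_le.trans ?_
      rw [div_le_iff₀ (by exact_mod_cast near_pos hn)]
      calc ((n * Nat.size n : ℕ) : ℝ) = Nat.size n * (n : ℝ) ^ (1 - y) * (n : ℝ) ^ y := by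
            rw [mul_assoc, ← Real.rpow_add hnpos, sub_add_cancel, Real.rpow_one]
            push_cast; ring
        _ ≤ _ := mul_le_mul_of_nonneg_left rpow_le_near (by positivity)
    have h3 : 1 ≤ Nat.size n * (n : ℝ) ^ (1 - y) := one_le_mul_of_one_le_of_one_le hL h1
    rw [pivots, Nat.cast_add, Nat.cast_one]
    linarith
  have hNpos : (1 : ℝ) ≤ pivots y n := by exact_mod_cast pivots_pos
  have hH : (level k y n : ℝ) ≤ 2 * (pivots y n : ℝ) ^ (1 / (k : ℝ)) := by
    have h2 : (level k y n : ℝ) < (pivots y n : ℝ) ^ (1 / (k : ℝ)) + 1 :=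
      Nat.ceil_lt_add_one (by positivity)
    have h3 : 1 ≤ (pivots y n : ℝ) ^ (1 / (k : ℝ)) := Real.one_le_rpow hNpos hk0.le
    linarith
  calc (pivots y n : ℝ) * level k y n
      ≤ pivots y n * (2 * (pivots y n : ℝ) ^ (1 / (k : ℝ))) :=
        mul_le_mul_of_nonneg_left hH (by linarith)
    _ = 2 * (pivots y n : ℝ) ^ (1 + 1 / (k : ℝ)) := by
        rw [Real.rpow_add (by linarith), Real.rpow_one]; ring
    _ ≤ 2 * (2 * Nat.size n * (n : ℝ) ^ (1 - y)) ^ (1 + 1 / (k : ℝ)) :=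
        mul_le_mul_of_nonneg_left (Real.rpow_le_rpow (by linarith) hN (by linarith)) (by norm_num)
    _ = 2 * ((2 * Nat.size n) ^ (1 + 1 / (k : ℝ)) * (n : ℝ) ^ ((1 - y) * (1 + 1 / (k : ℝ)))) := by
        rw [Real.mul_rpow (by positivity) (by positivity), ← Real.rpow_mul hnpos.le]
    _ ≤ 2 * ((2 * Nat.size n) ^ (2 : ℝ) * (n : ℝ) ^ ((1 - y) * (1 + 1 / (k : ℝ)))) := by
        have : (2 * (Nat.size n : ℝ)) ^ (1 + 1 / (k : ℝ)) ≤ (2 * Nat.size n) ^ (2 : ℝ) :=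
          Real.rpow_le_rpow_of_exponent_le (by linarith) (by linarith)
        have := mul_le_mul_of_nonneg_right this
          (Real.rpow_nonneg hnpos.le ((1 - y) * (1 + 1 / (k : ℝ))))
        linarith
    _ = _ := by rw [Real.rpow_two]; ring

theorem length_isBigO {α : ℝ} (hk : 0 < k) (hy0 : 0 ≤ y) (hy : y ≤ 1) (hα : 1 + y ≤ α)
    (hα' : (1 - y) * (1 + 1 / (k : ℝ)) ≤ α) :
    (fun n => (length k y n : ℝ)) =O[atTop] fun n : ℕ => (n : ℝ) ^ α * Real.log n ^ (k + 2) := by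
  refine Asymptotics.IsBigO.of_bound ((9 + 16 * k * 3 ^ k) * 4 ^ (k + 2)) ?_
  filter_upwards [eventually_ge_atTop 2] with n hn2
  have hn : 0 < n := by omega
  have hnR : (1 : ℝ) ≤ n := by exact_mod_cast hn
  have hnpos : (0 : ℝ) < n := by linarith
  have hL : (1 : ℝ) ≤ Nat.size n := by exact_mod_cast FitsWords.one_le_size hn
  have hlog : 0 ≤ Real.log n := Real.log_nonneg hnR
  rw [Real.norm_of_nonneg (by positivity), Real.norm_of_nonneg (by positivity)]
  have hA : 1 ≤ (n : ℝ) ^ α := Real.one_le_rpow hnR (by linarith)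
  have hP : (1 : ℝ) ≤ (Nat.size n : ℝ) ^ (k + 2) := one_le_pow₀ hL
  have h1 : (n : ℝ) * near y n ≤ 2 * (n : ℝ) ^ α := by
    calc (n : ℝ) * near y n ≤ n * (2 * (n : ℝ) ^ y) :=
          mul_le_mul_of_nonneg_left (near_le_rpow hn hy0) hnpos.le
      _ = 2 * (n : ℝ) ^ (1 + y) := by rw [Real.rpow_add hnpos, Real.rpow_one]; ring
      _ ≤ _ := mul_le_mul_of_nonneg_left (Real.rpow_le_rpow_of_exponent_le hnR hα) (by norm_num)
  have h2 : (pivots y n : ℝ) * level k y n ≤ 8 * (Nat.size n : ℝ) ^ 2 * (n : ℝ) ^ α :=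
    (pivots_mul_level_le hk hy hn).trans
      (mul_le_mul_of_nonneg_left (Real.rpow_le_rpow_of_exponent_le hnR hα') (by positivity))
  have h3 : (length k y n : ℝ) = n * near y n +
      (pivots y n * level k y n) * (2 * k * (3 ^ k * (Nat.size n : ℝ) ^ k)) + 7 := by
    rw [length]; push_cast; rw [mul_pow]; ring
  have h4 := mul_le_mul_of_nonneg_right h2
    (show 0 ≤ 2 * (k : ℝ) * (3 ^ k * (Nat.size n : ℝ) ^ k) by positivity)
  have h5 : (n : ℝ) ^ α ≤ (n : ℝ) ^ α * (Nat.size n : ℝ) ^ (k + 2) :=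
    le_mul_of_one_le_right (by linarith) hP
  have h6 : (Nat.size n : ℝ) ^ (k + 2) ≤ 4 ^ (k + 2) * Real.log n ^ (k + 2) := by
    rw [← mul_pow]
    exact pow_le_pow_left₀ (by linarith) (size_le_log hn2) _
  calc (length k y n : ℝ) ≤ 2 * (n : ℝ) ^ α + 8 * (Nat.size n : ℝ) ^ 2 * (n : ℝ) ^ α *
        (2 * k * (3 ^ k * (Nat.size n : ℝ) ^ k)) + 7 * (n : ℝ) ^ α := by rw [h3]; linarith
    _ = 9 * (n : ℝ) ^ α +
        16 * k * 3 ^ k * ((n : ℝ) ^ α * (Nat.size n : ℝ) ^ (k + 2)) := by ring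
    _ ≤ (9 + 16 * k * 3 ^ k) * ((n : ℝ) ^ α * (Nat.size n : ℝ) ^ (k + 2)) := by linarith
    _ ≤ (9 + 16 * k * 3 ^ k) * ((n : ℝ) ^ α * (4 ^ (k + 2) * Real.log n ^ (k + 2))) := by
        gcongr
    _ = _ := by ring

/-- The strict inequality leaves a power `n ^ ε`, which absorbs the logarithmic time of the
dictionary look-ups. -/
theorem time_isBigO {c : ℝ} {M : ℕ} (hy0 : 0 ≤ y) (hc : y * M < c) :
    (fun n => (time k M y n : ℝ)) =O[atTop] fun n : ℕ => (n : ℝ) ^ c := by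
  set ε := c - y * M with hε
  have hεpos : 0 < ε := by linarith
  refine Asymptotics.IsBigO.of_bound
    (4 ^ M * ((20 * M + 110 * k + 28 + 26 * k) * (4 / ε)) + 48) ?_
  filter_upwards [eventually_ge_atTop 2] with n hn2
  have hn : 0 < n := by omega
  have hnR : (1 : ℝ) ≤ n := by exact_mod_cast hn
  have hnpos : (0 : ℝ) < n := by linarith
  have hL : (1 : ℝ) ≤ Nat.size n := by exact_mod_cast FitsWords.one_le_size hn
  rw [Real.norm_of_nonneg (by positivity), Real.norm_of_nonneg (by positivity)]
  have hyM : 0 ≤ y * M := by positivity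
  have hA : 1 ≤ (n : ℝ) ^ c := Real.one_le_rpow hnR (by linarith)
  have h1 : (2 * (near y n : ℝ)) ^ M ≤ 4 ^ M * (n : ℝ) ^ (y * M) := by
    rw [Real.rpow_mul hnpos.le, Real.rpow_natCast, ← mul_pow]
    exact pow_le_pow_left₀ (by positivity) (by linarith [near_le_rpow hn hy0]) _
  have h2 : (Nat.size n : ℝ) ≤ 4 / ε * (n : ℝ) ^ ε := by
    have := Real.log_le_rpow_div hnpos.le hεpos
    calc (Nat.size n : ℝ) ≤ 4 * Real.log n := size_le_log hn2
      _ ≤ 4 * ((n : ℝ) ^ ε / ε) := by linarith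
      _ = _ := by ring
  have h3 : 20 * (M : ℝ) + 2 * k * (13 * (2 * Nat.size n) + 41) + 28 ≤
      (20 * M + 110 * k + 28 + 26 * k) * Nat.size n := by
    have e1 : 20 * (M : ℝ) ≤ 20 * M * Nat.size n := le_mul_of_one_le_right (by positivity) hL
    have e2 : (k : ℝ) ≤ k * Nat.size n := le_mul_of_one_le_right (by positivity) hL
    nlinarith
  calc (time k M y n : ℝ) = (2 * (near y n : ℝ)) ^ M *
        (20 * (M : ℝ) + 2 * k * (13 * (2 * Nat.size n) + 41) + 28) + 48 := by
        rw [time]; push_cast; ring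
    _ ≤ (4 ^ M * (n : ℝ) ^ (y * M)) *
        ((20 * M + 110 * k + 28 + 26 * k) * (4 / ε * (n : ℝ) ^ ε)) + 48 := by
        refine add_le_add (mul_le_mul h1 (h3.trans ?_) (by positivity) (by positivity)) le_rfl
        exact mul_le_mul_of_nonneg_left h2 (by positivity)
    _ = 4 ^ M * ((20 * M + 110 * k + 28 + 26 * k) * (4 / ε)) *
        ((n : ℝ) ^ (y * M) * (n : ℝ) ^ ε) + 48 := by ring
    _ = 4 ^ M * ((20 * M + 110 * k + 28 + 26 * k) * (4 / ε)) * (n : ℝ) ^ c + 48 := by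
        rw [← Real.rpow_add hnpos, hε, add_sub_cancel]
    _ ≤ 4 ^ M * ((20 * M + 110 * k + 28 + 26 * k) * (4 / ε)) * (n : ℝ) ^ c + 48 * (n : ℝ) ^ c := by
        linarith
    _ = _ := by ring

end OracleParams

/-! ### Choice of the parameters and conclusion -/

open OracleParams in
theorem corollary4 (k ℓ : ℕ) (hk : 0 < k) (hℓ : 0 < ℓ) (c : ℝ) (hc : 0 < c)
    (hc' : c ≤ (4 - 4 / (2 * (k : ℝ) + 1)) * (ℓ : ℝ)) :
    -- `q * Nat.size n` is the word length, `P` the query program, `S` the space, `T` the query time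
    ∃ (q : ℕ) (P : WordRAM.Program) (S T : ℕ → ℕ),
      (∃ j : ℕ, (fun n : ℕ => (S n : ℝ)) =O[atTop]
        fun n : ℕ => (n : ℝ) ^ (1 + 1 / (k : ℝ) * (1 - c / (8 * (ℓ : ℝ)))) * Real.log n ^ j) ∧
      ((fun n : ℕ => (T n : ℝ)) =O[atTop] fun n : ℕ => (n : ℝ) ^ c) ∧
      ∀ (n : ℕ) (W : ℝ≥0) (G : SimpleGraph (Fin n)) (w : Sym2 (Fin n) → ℝ≥0),
        (∀ e ∈ G.edgeSet, w e ≤ W) →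
        ∃ D : List ℕ,
          IsDistanceOracle (q * Nat.size n) P D G w W
            (ENNReal.ofReal (2 * (k : ℝ) - 1 + 1 / (ℓ : ℝ))) (4 * (k : ℝ≥0∞) * (W : ℝ≥0∞))
            (S n) (T n) := by
  have hkR : (1 : ℝ) ≤ k := by exact_mod_cast hk
  have hℓR : (1 : ℝ) ≤ ℓ := by exact_mod_cast hℓ
  set z := c / (8 * (ℓ : ℝ)) with hz
  have hcz : c = 8 * ℓ * z := by rw [hz]; field_simp
  -- With this `y` the exponent `(1 - y) * (1 + 1/k)` of the hub structure equals `1 + (1 - z)/k`.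
  set y := z / (k + 1) with hy
  have hzy : z = (k + 1) * y := by rw [hy]; field_simp
  have hz0 : 0 < z := by rw [hz]; positivity
  have hy0 : 0 < y := by rw [hy]; positivity
  -- The bound on `c` reads `c ≤ 8ℓ * k/(2k+1)`. It is used to make the near lists fit: `1 + y ≤ 1 +
  -- (1 - z)/k` amounts to `(2k+1) * y ≤ 1`.
  have hzk : (2 * k + 1) * z ≤ k := by
    have h1 : (4 - 4 / (2 * (k : ℝ) + 1)) * (ℓ : ℝ) = 8 * ℓ * (k / (2 * k + 1)) := by
      field_simp; ring
    rw [h1, hcz] at hc'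
    have h2 := le_of_mul_le_mul_left hc' (by positivity)
    rw [le_div_iff₀ (by positivity)] at h2
    linarith
  have hyk : (2 * k + 1) * y ≤ 1 := by
    rw [hzy] at hzk
    have : (2 * k + 1) * y * (k + 1) ≤ 1 * (k + 1) := by linarith
    exact le_of_mul_le_mul_right this (by linarith)
  have hy1 : y ≤ 1 := by nlinarith
  -- This is `2 * g + 2` with `g = 4 * k * ℓ`.
  set M := 8 * k * ℓ + 2 with hM
  have hspace : FitsWords fun n => (2 * k + 7) * length k y n :=
    (FitsWords.const _).mul (fitsWords_length hk hy1)
  have hinf : FitsWords fun n => (M + 4) * (6 * k * n * (4 * k * ℓ * n) + 1) :=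
    (FitsWords.const _).mul ((((FitsWords.const _).mul .id).mul
      ((FitsWords.const _).mul .id)).add (.const 1))
  have hcodes : FitsWords fun n => (2 * near y n) ^ M :=
    ((FitsWords.const 2).mul (fitsWords_near hy1)).pow M
  obtain ⟨q, hq⟩ := ((hspace.add hinf).add (FitsWords.id.mul .id)).add hcodes
  -- All numbers are at most `2 ^ (q * Nat.size n)`; the additional `Nat.size n` bits make the
  -- inequalities strict.
  refine ⟨q + 1, WordRAM.Code.query M k 0, fun n => (2 * k + 7) * length k y n, time k M y,
    ⟨k + 2, ?_⟩, ?_, ?_⟩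
  · simp only [Nat.cast_mul]
    refine (length_isBigO hk hy0.le hy1 ?_ ?_).const_mul_left _
    · have : y ≤ 1 / k * (1 - z) := by
        rw [div_mul_eq_mul_div, le_div_iff₀ (by linarith), one_mul, hzy]
        linarith
      linarith
    · refine le_of_eq ?_
      rw [hzy]; field_simp; ring
  · refine time_isBigO hy0.le ?_
    rw [hcz, hzy, hM]
    push_cast
    -- This is the gap `c - y * M`.
    have : 0 < y * (8 * ℓ - 2) := mul_pos hy0 (by linarith)
    linarith
  · intro n W G w hw
    rcases Nat.eq_zero_or_pos n with rfl | hn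
    · exact ⟨[], by simp, by simp, fun s => s.elim0⟩
    set b := (q + 1) * Nat.size n with hb
    have hbq : 2 ^ (q * Nat.size n) < 2 ^ b := by
      refine Nat.pow_lt_pow_right (by norm_num) ?_
      rw [hb, Nat.succ_mul]
      have := FitsWords.one_le_size hn
      omega
    have hqn : (2 * k + 7) * length k y n + (M + 4) * (6 * k * n * (4 * k * ℓ * n) + 1) + n * n +
      (2 * near y n) ^ M ≤ 2 ^ (q * Nat.size n) := hq n hn
    set Q := 4 * k * ℓ * n with hQ
    set INF := 6 * k * n * Q + 1 with hINF
    have hnL : n < 2 ^ Nat.size n := Nat.lt_size_self n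
    have hJ : n * n ≤ 2 ^ (2 * Nat.size n) := by
      rw [two_mul, pow_add]
      exact Nat.mul_le_mul hnL.le hnL.le
    have hscale : Q ≤ INF := by
      rw [hINF]
      have : Q ≤ 6 * k * n * Q := Nat.le_mul_of_pos_left _ (by positivity)
      omega
    obtain ⟨D, hDn, hDK, hDinf, hDscale, hfits, hwords, hD⟩ := WordRAM.exists_tables (M := M)
      (S := length k y n) (b := b) (J := 2 * Nat.size n) (INF := INF) (scale := Q)
      hn hk (near_pos hn) (near_le hn hy1) (Nat.succ_le_of_lt (level_pos (k := k) (y := y)))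
      (FitsWords.one_le_size hn) hnL.le (pivots_le_level_pow hk) (Nat.le_add_left _ _)
      (by rw [length, add_assoc]; exact Nat.le_add_right _ _)
      (by
        rw [length, add_assoc, add_left_comm]
        exact Nat.le_add_right _ _)
      hJ (by omega) (by omega) (by omega) (by omega) (by omega) hscale
      (G.cappedDist (roundedWeight w W Q) INF) (SimpleGraph.cappedDist_self _ _)
      (SimpleGraph.cappedDist_comm _ _) (SimpleGraph.cappedDist_triangle _ _)
      (SimpleGraph.cappedDist_le _ _)
    refine ⟨D.words M k (length k y n), hwords, by simp [WordRAM.Tables.words], fun s t => ?_⟩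
    obtain ⟨hlow, hupp⟩ := hD s t
    obtain ⟨τ, hτ, σ, hσ, hhalt, hres⟩ := hfits.query (s := s) (t := t) (by rw [hDn]; exact s.2)
      (by rw [hDn]; exact t.2)
    rw [hDK, hDinf, hDscale] at hres
    rw [hDK] at hτ
    refine ⟨τ, hτ, σ, hσ, hhalt,
      weightedDist_estimate hk hℓ hn hQ hINF hw hlow (fun hlt => ?_) hres⟩
    set δ := G.cappedDist (roundedWeight w W Q) INF s t
    have hkℓ : 0 < k * ℓ := Nat.mul_pos hk hℓ
    have hQn : 2 * k * ℓ * n + 2 * k * ℓ * n ≤ Q := by rw [hQ]; apply le_of_eq; ring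
    have hgQ : 2 * k * ℓ * n ≤ 4 * k * ℓ * Q :=
      (show 2 * k * ℓ * n ≤ Q by omega).trans (Nat.le_mul_of_pos_left _ (by positivity))
    -- The additive term `E` is `g * Q` less the slack `2kℓn` reserved for rounding. If `δ ≥ 2kℓn`,
    -- then `δ` makes up for the slack; otherwise `r ≤ δ` is at most half of `Q`, and `g * r` is far
    -- below `g * Q`.
    have hsmall : ∀ r ≤ Q, r ≤ δ →
        4 * k * ℓ * r ≤ δ + (4 * k * ℓ * Q - 2 * k * ℓ * n) := by
      intro r hrQ hrd
      rcases le_total (2 * k * ℓ * n) δ with h | h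
      · have := Nat.mul_le_mul_left (4 * k * ℓ) hrQ
        omega
      · have h1 := Nat.mul_le_mul_left (4 * k * ℓ) (show r + 2 * k * ℓ * n ≤ Q by omega)
        have h2 : 2 * k * ℓ * n ≤ 4 * k * ℓ * (2 * k * ℓ * n) :=
          Nat.le_mul_of_pos_left _ (by positivity)
        rw [mul_add] at h1
        omega
    obtain ⟨a, a', ha, ha', hbest⟩ := hupp Q (4 * k * ℓ) (4 * k * ℓ * Q - 2 * k * ℓ * n)
      (by rw [hM]; apply le_of_eq; ring)
      (fun x y hxy S hx hy => SimpleGraph.cappedDist_crossing _ _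
        (fun e he => roundedWeight_le hw he) hxy S hx hy) hsmall hlt
    -- Since `2 * k * ℓ` is half of `g`, the two radii together contribute at most `δ + E`, and `E +
    -- 2kℓn = 4kℓQ`.
    have h1 := Nat.mul_le_mul_left ℓ hbest
    have h2 : ℓ * (2 * k * δ + 2 * k * (a + a')) =
        2 * k * ℓ * δ + 2 * k * ℓ * a + 2 * k * ℓ * a' := by
      ring
    have h3 : 4 * k * ℓ * a = 2 * (2 * k * ℓ * a) := by ring
    have h4 : 4 * k * ℓ * a' = 2 * (2 * k * ℓ * a') := by ring
    rw [mul_add] at h1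
    omega
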